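/- Let $b\ge 2$, $\Sigma=\{0,\dots,b-1\}$, and let $(p_{ij})_{i,j\in\Sigma}$ be a stochastic matrix with $0<p_{ij}<1$ for all $i,j\in\Sigma$. Equip $\Sigma^\infty$ with the product of the discrete topologies and let $\mathcal C(\Sigma^\infty)$ be the Banach space of continuous functions $\Sigma^\infty\to\mathbb R$ with the supremum norm and its Borel $\sigma$-algebra. For $v=v_1v_2\ldots\in\Sigma^\infty$ write $\bar v=v_2v_3\ldots$, and let $j(v,w)\in\{0,1,2,\dots\}\cup\{\infty\}$ be the length of the longest common prefix of $v,w\in\Sigma^\infty$. For $r\in\Sigma$ let $S^{(r)}\in\Sigma^\infty$ be a Markov chain with transition matrix $(p_{ij})$ and initial distribution $(p_{r0},\dots,p_{r(b-1)})$, and put $$m_r(v)=\sum_{k\ge 0}\mathbb P\bigl(S^{(r)}\text{ starts with }v_1\ldots v_k\bigr)=1+\sum_{k\ge1}p_{rv_1}p_{v_1v_2}\cdots p_{v_{k-1}v_k},\qquad v\in\Sigma^\infty .$$ Let $N^{(r)}$ be a centered Gaussian vector in $\mathbb R^b$ with covariance matrix $\Omega^{(r)}$, where $\Omega^{(r)}_{ii}=p_{ri}(1-p_{ri})$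 and $\Omega^{(r)}_{ij}=-p_{ri}p_{rj}$ for $i\ne j$. Let $H_r$ be a centered Gaussian process indexed by $\Sigma^\infty$, with paths in $\mathcal C(\Sigma^\infty)$, such that $$\mathbb E[H_r(v)H_r(w)]=\operatorname{Cov}\bigl(j(v,S^{(r)}),\,j(w,S^{(r)})\bigr),\qquad v,w\in\Sigma^\infty .$$ Such processes $H_0,\dots,H_{b-1}$ exist, and the family of their laws is the unique family of laws (Borel probability measures) of $\mathcal C(\Sigma^\infty)$-valued random variables $X_0,\dots,X_{b-1}$ satisfying $$X_r\stackrel{d}{=}\Bigl(\sqrt{p_{rv_1}}\,X_{v_1}(\bar v)+m_{v_1}(\bar v)\,N^{(r)}_{v_1}\Bigr)_{v\in\Sigma^\infty}\qquad\text{for all } r\in\Sigma,$$ where, on the right-hand side, $X_0,\dots,X_{b-1},N^{(r)}$ are independent. That is, the laws of $H_0,\dots,H_{b-1}$ satisfy this system, and any family of laws on $\mathcal C(\Sigma^\infty)$ that satisfies it, with no moment condition, consists of the laws of $H_0,\dots,H_{b-1}$. -/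

import Mathlib

open MeasureTheory ProbabilityTheory
open scoped Topology ENNReal

noncomputable section

/-- The infinite strings over the alphabet `{0, …, b-1}`. The letters are indexed from `0`, so that
`w 0` is the first letter. The topology is the product of the discrete ones. -/
abbrev InfString (b : ℕ) : Type := ℕ → Fin b

/-- The string with its first letter removed. -/
def InfString.tail {b : ℕ} (w : InfString b) : InfString b := fun n => w (n + 1)

open Classical in
/-- Length of the longest common prefix of two strings (infinite if they are equal). -/
def coincidence {b : ℕ} (v w : InfString b) : ℕ∞ :=
  if v = w then ⊤ else (PiNat.firstDiff v w : ℕ∞)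

/-- The Banach space of continuous real functions on the strings, with the supremum norm. -/
abbrev PathSpace (b : ℕ) : Type := C(InfString b, ℝ)

/-- The path space carries its Borel sigma-algebra. -/
instance PathSpace.instMeasurableSpace (b : ℕ) : MeasurableSpace (PathSpace b) := borel _

instance PathSpace.instBorelSpace (b : ℕ) : BorelSpace (PathSpace b) := ⟨rfl⟩

/-- Transition matrix of a Markov chain on the alphabet, with all entries strictly between
`0` and `1`. -/
structure TransitionMatrix (b : ℕ) where
  prob : Fin b → Fin b → ℝ
  pos : ∀ i j, 0 < prob i j
  lt_one : ∀ i j, prob i j < 1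
  row_sum : ∀ i, ∑ j, prob i j = 1

/-- The measure on the alphabet with the weights `μ`. -/
def letterLaw {b : ℕ} (μ : Fin b → ℝ) : Measure (Fin b) :=
  ∑ r, ENNReal.ofReal (μ r) • Measure.dirac r

lemma letterLaw_singleton {b : ℕ} (μ : Fin b → ℝ) (r : Fin b) :
    letterLaw μ {r} = ENNReal.ofReal (μ r) := by
  classical
  simp [letterLaw, Measure.finsetSum_apply, Set.indicator_apply]

namespace TransitionMatrix

variable {b : ℕ} (P : TransitionMatrix b)

instance isProbabilityMeasure_letterLaw (r : Fin b) :
    IsProbabilityMeasure (letterLaw (P.prob r)) := by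
  constructor
  simp only [letterLaw, Measure.finsetSum_apply, Measure.smul_apply, measure_univ, smul_eq_mul,
    mul_one]
  rw [← ENNReal.ofReal_sum_of_nonneg (fun j _ => (P.pos r j).le), P.row_sum, ENNReal.ofReal_one]

/-- The kernel that draws letter number `n + 1` given the letters `0, …, n`: it depends only on
letter `n`, through the corresponding row of the transition matrix. -/
def stepKernel (n : ℕ) : Kernel ((_i : Finset.Iic n) → Fin b) (Fin b) :=
  (Kernel.ofFunOfCountable fun r : Fin b => letterLaw (P.prob r)).comap
    (fun x => x ⟨n, Finset.mem_Iic.2 le_rfl⟩) (measurable_pi_apply _)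

lemma stepKernel_apply (n : ℕ) (x : (_i : Finset.Iic n) → Fin b) :
    P.stepKernel n x = letterLaw (P.prob (x ⟨n, Finset.mem_Iic.2 le_rfl⟩)) := rfl

instance isMarkovKernel_stepKernel (n : ℕ) : IsMarkovKernel (P.stepKernel n) :=
  ⟨fun x => by rw [stepKernel_apply]; infer_instance⟩

/-- Law of the random string produced by the Markov chain with initial weights `μ`. -/
def sourceLaw (μ : Fin b → ℝ) : Measure (InfString b) :=
  ((letterLaw μ).map fun r (_ : Finset.Iic 0) => r).bind
    (Kernel.traj (X := fun _ => Fin b) P.stepKernel 0)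

/-- The probability that the chain with initial weights `μ` starts with the first `k` letters
of `w`. -/
def prefixProb (μ : Fin b → ℝ) (w : InfString b) : ℕ → ℝ
  | 0 => 1
  | k + 1 => μ (w 0) * ∏ i ∈ Finset.range k, P.prob (w i) (w (i + 1))

/-- The sum of the prefix probabilities over all finite prefixes of `w`. -/
def meanFun (μ : Fin b → ℝ) (w : InfString b) : ℝ := ∑' k, P.prefixProb μ w k

lemma exists_bound : ∃ q : ℝ, 0 ≤ q ∧ q < 1 ∧ ∀ i j, P.prob i j ≤ q := by
  rcases isEmpty_or_nonempty (Fin b) with h | h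
  · exact ⟨0, le_rfl, one_pos, fun i => h.elim i⟩
  · obtain ⟨x, hx⟩ := Finite.exists_max fun ij : Fin b × Fin b => P.prob ij.1 ij.2
    exact ⟨_, (P.pos x.1 x.2).le, P.lt_one x.1 x.2, fun i j => hx (i, j)⟩

lemma continuous_meanFun (r : Fin b) : Continuous (P.meanFun (P.prob r)) := by
  obtain ⟨q, hq0, hq1, hq⟩ := P.exists_bound
  refine continuous_tsum (u := fun k => q ^ k) (fun k => ?_)
    (summable_geometric_of_lt_one hq0 hq1) fun k w => ?_
  · cases k with
    | zero => exact continuous_const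
    | succ k =>
      have h (f : Fin b → ℝ) (i : ℕ) : Continuous fun w : InfString b => f (w i) :=
        (continuous_of_discreteTopology (f := f)).comp (continuous_apply i)
      have h2 (i : ℕ) : Continuous fun w : InfString b => P.prob (w i) (w (i + 1)) :=
        (continuous_of_discreteTopology (f := fun x : Fin b × Fin b => P.prob x.1 x.2)).comp
          (f := fun w : InfString b => (w i, w (i + 1))) (by fun_prop)
      exact (h _ 0).mul (continuous_finsetProd _ fun i _ => h2 i)
  · cases k with
    | zero => simp [prefixProb]
    | succ k =>
      rw [prefixProb, Real.norm_eq_abs, abs_mul, Finset.abs_prod, pow_succ']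
      refine mul_le_mul (by rw [abs_of_pos (P.pos _ _)]; exact hq _ _) ?_
        (Finset.prod_nonneg fun _ _ => abs_nonneg _) hq0
      calc _ ≤ ∏ _i ∈ Finset.range k, q := Finset.prod_le_prod (fun _ _ => abs_nonneg _)
            fun i _ => by rw [abs_of_pos (P.pos _ _)]; exact hq _ _
        _ = q ^ k := by simp

lemma _root_.InfString.continuous_tail : Continuous (InfString.tail (b := b)) :=
  continuous_pi fun n => continuous_apply (n + 1)

lemma _root_.InfString.continuous_split {f : Fin b → InfString b → ℝ} (hf : ∀ i, Continuous (f i)) :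
    Continuous fun w : InfString b => f (w 0) w.tail :=
  (continuous_prod_of_discrete_left (f := fun x : Fin b × InfString b => f x.1 x.2)).2 hf
    |>.comp ((continuous_apply 0).prodMk InfString.continuous_tail)

/-- Covariance matrix of one draw from row `r` of the transition matrix. -/
def noiseCov (r : Fin b) : Matrix (Fin b) (Fin b) ℝ := fun i j =>
  if i = j then P.prob r i * (1 - P.prob r i) else -(P.prob r i * P.prob r j)

/-- The matrix `noiseCov` is a genuine covariance matrix. -/
lemma posSemidef_noiseCov (r : Fin b) : (P.noiseCov r).PosSemidef := by
  have h : P.noiseCov r = Matrix.diagonal (P.prob r) - Matrix.vecMulVec (P.prob r) (P.prob r) := by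
    ext i j
    by_cases hij : i = j
    · subst hij; simp [noiseCov, Matrix.vecMulVec_apply]; ring
    · simp [noiseCov, Matrix.vecMulVec_apply, hij]
  refine Matrix.PosSemidef.of_dotProduct_mulVec_nonneg ?_ fun x => ?_
  · ext i j
    by_cases hij : i = j
    · subst hij; simp [noiseCov]
    · simp [noiseCov, hij, Ne.symm hij, mul_comm]
  · have key := Finset.sum_sq_le_sum_mul_sum_of_sq_le_mul Finset.univ
      (r := fun i => P.prob r i * x i) (f := P.prob r) (g := fun i => P.prob r i * x i ^ 2)
      (fun i _ => (P.pos r i).le) (fun i _ => mul_nonneg (P.pos r i).le (sq_nonneg _))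
      (fun i _ => le_of_eq (by ring))
    rw [P.row_sum, one_mul] at key
    have e : star x ⬝ᵥ (P.noiseCov r).mulVec x
        = ∑ i, P.prob r i * x i ^ 2 - (∑ i, P.prob r i * x i) ^ 2 := by
      rw [h, Matrix.sub_mulVec, dotProduct_sub, Matrix.vecMulVec_mulVec]
      congr 1
      · simp only [dotProduct, Matrix.mulVec_diagonal]
        exact Finset.sum_congr rfl fun i _ => by simp; ring
      · have hs : P.prob r ⬝ᵥ x = ∑ i, P.prob r i * x i := rfl
        have hs' : star x ⬝ᵥ P.prob r = ∑ i, P.prob r i * x i := by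
          simp [dotProduct, mul_comm]
        rw [hs, dotProduct_smul, hs']
        simp [sq]
    rw [e]; linarith

/-- The centered Gaussian law on `ℝ^b` with covariance matrix `noiseCov r`. -/
def noiseLaw (r : Fin b) : Measure (EuclideanSpace ℝ (Fin b)) :=
  multivariateGaussian 0 (P.noiseCov r)

/-- The operator that sends `x ∈ ℝ^b` to the function `w ↦ m_i (tail w) * x i` with `i = w 0`,
where `m_i` is `meanFun` for the chain whose initial law is row `i`. -/
def noiseOp (x : EuclideanSpace ℝ (Fin b)) : PathSpace b where
  toFun w := P.meanFun (P.prob (w 0)) w.tail * x (w 0)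
  continuous_toFun := InfString.continuous_split
    (f := fun i v => P.meanFun (P.prob i) v * x i)
    fun i => (P.continuous_meanFun i).mul continuous_const

/-- The function `w ↦ √(p_{r i}) * X_i (tail w) + noiseOp x w` with `i = w 0`. -/
def fixedPointMap (r : Fin b) (X : Fin b → PathSpace b) (x : EuclideanSpace ℝ (Fin b)) :
    PathSpace b where
  toFun w := √(P.prob r (w 0)) * X (w 0) w.tail + P.noiseOp x w
  continuous_toFun := (InfString.continuous_split
    (f := fun i v => √(P.prob r i) * X i v)
    fun i => continuous_const.mul (X i).continuous).add (P.noiseOp x).continuous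

/-- The family of laws `X` solves the system of distributional fixed-point equations: for every
`r`, the law `X r` is that of `fixedPointMap r (X_0, …, X_{b-1}) N`, where
`X_0, …, X_{b-1}, N` are independent, `X_k` has the law `X k` and `N` has the law `noiseLaw r`. -/
def SolvesFixedPointSystem (X : Fin b → ProbabilityMeasure (PathSpace b)) : Prop :=
  ∀ r, (X r : Measure (PathSpace b)) =
    ((Measure.pi fun k => (X k : Measure (PathSpace b))).prod (P.noiseLaw r)).map
      fun z => P.fixedPointMap r z.1 z.2

/-- `H` is the law of a centered Gaussian process with continuous paths, indexed by the strings,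
whose covariance function is the covariance of the coincidences of `v` and of `w` with a random
string from the Markov source with initial weights `μ`. (The coincidences are almost surely
finite; `toNat` turns them into numbers.) -/
structure IsLimitLaw (μ : Fin b → ℝ) (H : ProbabilityMeasure (PathSpace b)) : Prop where
  gaussian : IsGaussianProcess (fun (v : InfString b) (f : PathSpace b) => f v)
    (H : Measure (PathSpace b))
  centered : ∀ v, ∫ f, f v ∂(H : Measure (PathSpace b)) = 0
  covariance : ∀ v w, ∫ f, f v * f w ∂(H : Measure (PathSpace b)) =
    cov[fun s => ((coincidence v s).toNat : ℝ), fun s => ((coincidence w s).toNat : ℝ);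
      P.sourceLaw μ]

end TransitionMatrix

end

/-!
The argument rests on joint characteristic functions of evaluations,
`∫ exp (i ∑ t_j f (v_j)) dν(f)` for finitely many strings `v_j`, called `jointCharFun`.
They determine a law `ν` on the separable space of paths (`PathSpace.ext_of_jointCharFun`), and on them the fixed-point map
acts as a product over the first letter of the strings, times the characteristic function of the
noise (`TransitionMatrix.jointCharFun_map_fixedPointMap`).

*Uniqueness.* After `n` iterations the finitely many strings are distributed over the words of
length `n`, and the frequencies are multiplied by at most `√q ^ n`, where `q < 1` bounds the
transition probabilities. Words that contain no string contribute a factor `1`, so at most as many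
factors matter as there are strings, whatever `n` is. The joint characteristic functions of two
solutions therefore differ by at most a fixed multiple of a modulus of continuity at `0`,
evaluated at an argument that tends to `0` (`TransitionMatrix.norm_jointCharFun_sub_le`). A
continuous function has finite norm, hence this modulus tends to `0` without any moment condition.

*The limit laws solve the system.* Both sides are centered Gaussian, so it suffices to compare
covariances. The first letter of the Markov chain is drawn from row `r`, and given that it is `a`
the remaining string comes from the chain started from row `a`
(`TransitionMatrix.sourceLaw_eq_sum`). The coincidence with `v` vanishes unless `a` is the first
letter of `v`, and otherwise is one more than the coincidence of the tails, which gives the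
recursion `TransitionMatrix.coincidenceCov_recursion`.

*Existence.* The coincidence of `v` with a string `s` is the sum over `k ≥ 1` of the indicators of
the events that `s` shares the first `k` letters of `v`. An isonormal Gaussian process on `L²` of
the source law (`exists_isonormal`), applied to these indicators after centering and summed over
`k`, is a Gaussian process with the required covariance. The sum converges uniformly in `v`: the
`k`-th term takes one value for each word of length `k`, the sum of the fourth moments of these
values is of order `q ^ k`, and hence so is the fourth moment of their maximum
(`TransitionMatrix.ae_summable_levelNoise`).
-/

noncomputable section

/-! ### Joint characteristic functions and uniqueness -/

/-- The joint characteristic function of the evaluations at the strings `v j`, `j ∈ J`, under a law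
`ν` on the path space, at the frequencies `t j`. -/
def jointCharFun {b : ℕ} {ι : Type*} (ν : Measure (PathSpace b)) (J : Finset ι) (t : ι → ℝ)
    (v : ι → InfString b) : ℂ :=
  ∫ f, Complex.exp ((∑ j ∈ J, t j * f (v j) : ℝ) * Complex.I) ∂ν

lemma PathSpace.measurable_sum_eval {b : ℕ} {ι : Type*} (J : Finset ι) (t : ι → ℝ)
    (v : ι → InfString b) : Measurable fun f : PathSpace b => ∑ j ∈ J, t j * f (v j) :=
  Continuous.measurable (by fun_prop)

lemma measurable_expI {Ω : Type*} [MeasurableSpace Ω] {g : Ω → ℝ} (hg : Measurable g) :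
    Measurable fun x => Complex.exp ((g x : ℂ) * Complex.I) := by fun_prop

lemma integrable_expI {Ω : Type*} [MeasurableSpace Ω] {μ : Measure Ω} [IsFiniteMeasure μ]
    {g : Ω → ℝ} (hg : AEMeasurable g μ) :
    Integrable (fun x => Complex.exp ((g x : ℂ) * Complex.I)) μ :=
  Integrable.of_bound (C := 1) (by fun_prop) <| by simp [Complex.norm_exp_ofReal_mul_I]

lemma norm_integral_expI_le_one {Ω : Type*} [MeasurableSpace Ω] {μ : Measure Ω}
    [IsProbabilityMeasure μ] (g : Ω → ℝ) :
    ‖∫ x, Complex.exp ((g x : ℂ) * Complex.I) ∂μ‖ ≤ 1 := by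
  simpa using norm_integral_le_of_norm_le_const (μ := μ) (C := 1)
    (f := fun x => Complex.exp ((g x : ℂ) * Complex.I))
    (by simp [Complex.norm_exp_ofReal_mul_I])

/-- The joint characteristic functions of all finite families of evaluations determine a law on
the path space. -/
lemma PathSpace.ext_of_jointCharFun {b : ℕ} {ν ν' : Measure (PathSpace b)} [IsFiniteMeasure ν]
    [IsFiniteMeasure ν']
    (h : ∀ (J : Finset (InfString b)) (t : InfString b → ℝ),
      jointCharFun ν J t id = jointCharFun ν' J t id) : ν = ν' := by
  -- The frequencies carry the discrete topology: the strings in a pairing are then locally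
  -- constant, and joint continuity reduces to continuity of finitely many evaluations.
  let _ : TopologicalSpace (InfString b →₀ ℝ) := ⊥
  have : DiscreteTopology (InfString b →₀ ℝ) := ⟨rfl⟩
  let L : PathSpace b →ₗ[ℝ] (InfString b →₀ ℝ) →ₗ[ℝ] ℝ :=
    LinearMap.mk₂ ℝ (fun f w => ∑ v ∈ w.support, w v * f v)
      (fun f g w => by simp [mul_add, Finset.sum_add_distrib])
      (fun c f w => by simp [Finset.mul_sum, mul_left_comm])
      (fun f w w' => Finsupp.sum_add_index' (h := fun v t => t * f v) (by simp)
        (by simp [add_mul]))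
      (fun c f w => by
        change Finsupp.sum (c • w) (fun v t => t * f v) = c • Finsupp.sum w fun v t => t * f v
        rw [Finsupp.sum_smul_index' (by simp), Finsupp.smul_sum]
        simp [mul_assoc])
  have hL (f : PathSpace b) (w : InfString b →₀ ℝ) : L f w = ∑ v ∈ w.support, w v * f v := rfl
  have hcont : Continuous fun p : PathSpace b × (InfString b →₀ ℝ) => L p.1 p.2 := by
    refine continuous_prod_of_discrete_right.2 fun w => ?_
    simp only [hL]
    fun_prop
  refine ext_of_integral_char_eq Real.continuous_probChar
    Real.probChar_ne_one (L := L) ?_ hcont fun w => h w.support w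
  intro f hf h0
  refine hf (ContinuousMap.ext fun v => ?_)
  have := congrArg (fun l => l (Finsupp.single v 1)) h0
  classical
  by_contra hne
  simp [hL] at this
  exact hne this

lemma norm_prod_sub_prod_le_sum {ι : Type*} (s : Finset ι) (x y : ι → ℂ) (hx : ∀ i, ‖x i‖ ≤ 1)
    (hy : ∀ i, ‖y i‖ ≤ 1) : ‖∏ i ∈ s, x i - ∏ i ∈ s, y i‖ ≤ ∑ i ∈ s, ‖x i - y i‖ := by
  classical
  induction s using Finset.induction_on with
  | empty => simp
  | insert a s ha ih =>
    rw [Finset.prod_insert ha, Finset.prod_insert ha, Finset.sum_insert ha]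
    have h1 : x a * ∏ i ∈ s, x i - y a * ∏ i ∈ s, y i
        = (x a - y a) * ∏ i ∈ s, x i + y a * (∏ i ∈ s, x i - ∏ i ∈ s, y i) := by ring
    have h2 : ‖∏ i ∈ s, x i‖ ≤ 1 := by
      rw [norm_prod]; exact Finset.prod_le_one (fun _ _ => norm_nonneg _) fun i _ => hx i
    rw [h1]
    refine (norm_add_le _ _).trans (add_le_add ?_ ?_)
    · rw [norm_mul]; exact mul_le_of_le_one_right (norm_nonneg _) h2
    · rw [norm_mul]; exact (mul_le_of_le_one_left (norm_nonneg _) (hy a)).trans ih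

/-- A bound for `1 - jointCharFun` in terms of the total mass `s` of the frequencies. It tends to
`0` with `s`, whatever the tails of the law. -/
def charModulus {b : ℕ} (ν : Measure (PathSpace b)) (s : ℝ) : ℝ := ∫ f, min (s * ‖f‖) 2 ∂ν

lemma charModulus_nonneg {b : ℕ} {ν : Measure (PathSpace b)} {s : ℝ} (hs : 0 ≤ s) :
    0 ≤ charModulus ν s :=
  integral_nonneg fun f => le_min (by positivity) (by norm_num)

section charModulus

variable {b : ℕ} {ν : Measure (PathSpace b)} [IsProbabilityMeasure ν]

lemma integrable_min_mul_norm (s : ℝ) (hs : 0 ≤ s) :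
    Integrable (fun f : PathSpace b => min (s * ‖f‖) 2) ν := by
  refine Integrable.of_bound (C := 2) (Continuous.aestronglyMeasurable (by fun_prop)) ?_
  refine ae_of_all _ fun f => ?_
  rw [Real.norm_eq_abs, abs_of_nonneg (le_min (by positivity) (by norm_num))]
  exact min_le_right _ _

lemma charModulus_mono {s s' : ℝ} (hs : 0 ≤ s) (h : s ≤ s') :
    charModulus ν s ≤ charModulus ν s' :=
  integral_mono (integrable_min_mul_norm s hs) (integrable_min_mul_norm s' (hs.trans h))
    fun f => min_le_min_right _ (mul_le_mul_of_nonneg_right h (norm_nonneg f))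

lemma tendsto_charModulus {s : ℕ → ℝ} (hs : ∀ n, 0 ≤ s n)
    (h : Filter.Tendsto s Filter.atTop (𝓝 0)) :
    Filter.Tendsto (fun n => charModulus ν (s n)) Filter.atTop (𝓝 0) := by
  have := tendsto_integral_of_dominated_convergence (μ := ν)
    (F := fun n (f : PathSpace b) => min (s n * ‖f‖) 2) (f := fun _ => (0 : ℝ)) (fun _ => (2 : ℝ))
    (fun n => (integrable_min_mul_norm (s n) (hs n)).1) (integrable_const _)
    (fun n => ae_of_all _ fun f => by
      rw [Real.norm_eq_abs, abs_of_nonneg (le_min (mul_nonneg (hs n) (norm_nonneg _))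
        (by norm_num))]
      exact min_le_right _ _)
    (ae_of_all _ fun f => by
      have h1 : Filter.Tendsto (fun n => s n * ‖f‖) Filter.atTop (𝓝 (0 * ‖f‖)) :=
        h.mul_const _
      simpa using h1.min (tendsto_const_nhds (x := (2 : ℝ))))
  simpa [charModulus] using this

lemma norm_jointCharFun_sub_one_le {ι : Type*} (J : Finset ι) (t : ι → ℝ) (v : ι → InfString b) :
    ‖jointCharFun ν J t v - 1‖ ≤ charModulus ν (∑ j ∈ J, |t j|) := by
  have h1 : jointCharFun ν J t v - 1
      = ∫ f, (Complex.exp ((∑ j ∈ J, t j * f (v j) : ℝ) * Complex.I) - 1) ∂ν := by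
    rw [integral_sub (integrable_expI (PathSpace.measurable_sum_eval J t v).aemeasurable)
      (integrable_const _)]
    simp [jointCharFun]
  rw [h1]
  refine norm_integral_le_of_norm_le
    (integrable_min_mul_norm _ (Finset.sum_nonneg fun _ _ => abs_nonneg _))
    (ae_of_all _ fun f => le_min ?_ ?_)
  · rw [mul_comm]
    refine Real.norm_exp_I_mul_ofReal_sub_one_le.trans ?_
    refine (norm_sum_le _ _).trans ?_
    rw [Finset.sum_mul]
    refine Finset.sum_le_sum fun j _ => ?_
    rw [norm_mul, Real.norm_eq_abs]
    exact mul_le_mul_of_nonneg_left (f.norm_coe_le_norm _) (abs_nonneg _)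
  · refine (norm_sub_le _ _).trans ?_
    rw [Complex.norm_exp_ofReal_mul_I]
    norm_num

end charModulus

namespace TransitionMatrix

variable {b : ℕ} (P : TransitionMatrix b)

lemma continuous_fixedPointMap (r : Fin b) :
    Continuous fun z : (Fin b → PathSpace b) × EuclideanSpace ℝ (Fin b) =>
      P.fixedPointMap r z.1 z.2 := by
  refine ContinuousMap.continuous_of_continuous_uncurry _ ?_
  have h : Continuous fun y : Fin b × (((Fin b → PathSpace b) × EuclideanSpace ℝ (Fin b)) ×
      InfString b) => √(P.prob r y.1) * y.2.1.1 y.1 y.2.2 +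
        P.meanFun (P.prob y.1) y.2.2 * y.2.1.2 y.1 := by
    refine continuous_prod_of_discrete_left.2 fun a => ?_
    have h1 : Continuous fun x : ((Fin b → PathSpace b) × EuclideanSpace ℝ (Fin b)) ×
        InfString b => √(P.prob r a) * x.1.1 a x.2 := continuous_const.mul
      (((continuous_apply a).comp (continuous_fst.comp continuous_fst)).eval continuous_snd)
    have h2 : Continuous fun x : ((Fin b → PathSpace b) × EuclideanSpace ℝ (Fin b)) ×
        InfString b => P.meanFun (P.prob a) x.2 * x.1.2 a := by
      have := P.continuous_meanFun a
      fun_prop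
    exact h1.add h2
  exact h.comp (f := fun y : ((Fin b → PathSpace b) × EuclideanSpace ℝ (Fin b)) × InfString b =>
    (y.2 0, (y.1, y.2.tail))) (((continuous_apply 0).comp continuous_snd).prodMk
      (continuous_fst.prodMk (InfString.continuous_tail.comp continuous_snd)))

/-- The characteristic function of the noise term in the fixed-point equation, at the
frequencies `t j` of the evaluations at `v j`. -/
def noiseCharFun {ι : Type*} (r : Fin b) (J : Finset ι) (t : ι → ℝ) (v : ι → InfString b) : ℂ :=
  ∫ x, Complex.exp ((∑ j ∈ J, t j * P.noiseOp x (v j) : ℝ) * Complex.I) ∂(P.noiseLaw r)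

instance (r : Fin b) : IsProbabilityMeasure (P.noiseLaw r) := by
  unfold noiseLaw; infer_instance

/-- On the level of joint characteristic functions, the fixed-point map splits the strings
according to their first letters. -/
lemma jointCharFun_map_fixedPointMap {ι : Type*} (X : Fin b → Measure (PathSpace b))
    [∀ a, IsProbabilityMeasure (X a)] (r : Fin b) (J : Finset ι) (t : ι → ℝ)
    (v : ι → InfString b) :
    jointCharFun (((Measure.pi X).prod (P.noiseLaw r)).map fun z => P.fixedPointMap r z.1 z.2)
        J t v
      = (∏ a, jointCharFun (X a) (J.filter fun j => v j 0 = a) (fun j => √(P.prob r a) * t j)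
          fun j => (v j).tail) * P.noiseCharFun r J t v := by
  rw [jointCharFun, integral_map (P.continuous_fixedPointMap r).measurable.aemeasurable
    (measurable_expI (PathSpace.measurable_sum_eval J t v)).aestronglyMeasurable]
  have h (z : (Fin b → PathSpace b) × EuclideanSpace ℝ (Fin b)) :
      Complex.exp ((∑ j ∈ J, t j * P.fixedPointMap r z.1 z.2 (v j) : ℝ) * Complex.I)
        = (∏ a, Complex.exp ((∑ j ∈ J.filter (fun j => v j 0 = a),
            √(P.prob r a) * t j * z.1 a (v j).tail : ℝ) * Complex.I)) *
          Complex.exp ((∑ j ∈ J, t j * P.noiseOp z.2 (v j) : ℝ) * Complex.I) := by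
    rw [← Complex.exp_sum, ← Complex.exp_add, ← Finset.sum_mul, ← add_mul, ← Complex.ofReal_sum,
      ← Complex.ofReal_add]
    congr 3
    have h1 : ∑ a, ∑ j ∈ J.filter (fun j => v j 0 = a), √(P.prob r a) * t j * z.1 a (v j).tail
        = ∑ j ∈ J, √(P.prob r (v j 0)) * t j * z.1 (v j 0) (v j).tail := by
      rw [← Finset.sum_fiberwise J (fun j => v j 0)]
      refine Finset.sum_congr rfl fun a _ => Finset.sum_congr rfl fun j hj => ?_
      rw [(Finset.mem_filter.1 hj).2]
    rw [h1, ← Finset.sum_add_distrib]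
    refine Finset.sum_congr rfl fun j _ => ?_
    change t j * (√(P.prob r (v j 0)) * z.1 (v j 0) (v j).tail + P.noiseOp z.2 (v j)) = _
    ring
  simp_rw [h]
  rw [integral_prod_mul (f := fun g : Fin b → PathSpace b => ∏ a, Complex.exp
      ((∑ j ∈ J.filter (fun j => v j 0 = a), √(P.prob r a) * t j * g a (v j).tail : ℝ)
        * Complex.I))
    (g := fun x => Complex.exp ((∑ j ∈ J, t j * P.noiseOp x (v j) : ℝ) * Complex.I)),
    integral_fintype_prod_eq_prod (fun (a : Fin b) (f : PathSpace b) => Complex.exp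
      ((∑ j ∈ J.filter (fun j => v j 0 = a), √(P.prob r a) * t j * f (v j).tail : ℝ)
        * Complex.I))]
  rfl

/-- Iterating the fixed-point equation `n` times scales the frequencies of two solutions down by
`√q ^ n`, while the finitely many strings are distributed over at most `#J` words. -/
lemma norm_jointCharFun_sub_le {X Y : Fin b → ProbabilityMeasure (PathSpace b)}
    (hX : P.SolvesFixedPointSystem X) (hY : P.SolvesFixedPointSystem Y) {q : ℝ}
    (hq : ∀ i j, P.prob i j ≤ q) (n : ℕ) {ι : Type*} (r : Fin b) (J : Finset ι) (t : ι → ℝ)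
    (v : ι → InfString b) :
    ‖jointCharFun (X r : Measure (PathSpace b)) J t v
        - jointCharFun (Y r : Measure (PathSpace b)) J t v‖
      ≤ J.card * ∑ a, (charModulus (X a : Measure (PathSpace b)) (√q ^ n * ∑ j ∈ J, |t j|)
          + charModulus (Y a : Measure (PathSpace b)) (√q ^ n * ∑ j ∈ J, |t j|)) := by
  induction n generalizing r J t v with
  | zero =>
    -- An empty family gives the characteristic function `1` on both sides. This is what keeps the
    -- number of contributing words bounded by `#J`.
    rcases J.eq_empty_or_nonempty with rfl | hJ
    · simp [jointCharFun]
    · have hs : 0 ≤ ∑ j ∈ J, |t j| := Finset.sum_nonneg fun _ _ => abs_nonneg _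
      have h0 (a : Fin b) : 0 ≤ charModulus (X a : Measure (PathSpace b)) (∑ j ∈ J, |t j|)
          + charModulus (Y a : Measure (PathSpace b)) (∑ j ∈ J, |t j|) :=
        add_nonneg (charModulus_nonneg hs) (charModulus_nonneg hs)
      simp only [pow_zero, one_mul]
      calc _ = ‖(jointCharFun (X r : Measure (PathSpace b)) J t v - 1)
            - (jointCharFun (Y r : Measure (PathSpace b)) J t v - 1)‖ := by ring_nf
        _ ≤ _ := norm_sub_le _ _
        _ ≤ _ := add_le_add (norm_jointCharFun_sub_one_le J t v)
            (norm_jointCharFun_sub_one_le J t v)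
        _ ≤ _ := Finset.single_le_sum (f := fun a =>
            charModulus (X a : Measure (PathSpace b)) (∑ j ∈ J, |t j|)
            + charModulus (Y a : Measure (PathSpace b)) (∑ j ∈ J, |t j|))
            (fun a _ => h0 a) (Finset.mem_univ r)
        _ ≤ _ := le_mul_of_one_le_left (Finset.sum_nonneg fun a _ => h0 a)
            (by exact_mod_cast hJ.card_pos)
  | succ n ih =>
    rw [hX r, hY r, P.jointCharFun_map_fixedPointMap, P.jointCharFun_map_fixedPointMap, ← sub_mul,
      norm_mul]
    refine (mul_le_of_le_one_right (norm_nonneg _) (norm_integral_expI_le_one _)).trans ?_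
    refine (norm_prod_sub_prod_le_sum _ _ _ (fun a => norm_integral_expI_le_one _)
      fun a => norm_integral_expI_le_one _).trans ?_
    refine (Finset.sum_le_sum fun a _ => ih a _ _ _).trans ?_
    have hcard : (J.card : ℝ) = ∑ a : Fin b, ((J.filter fun j => v j 0 = a).card : ℝ) := by
      rw [Finset.card_eq_sum_card_fiberwise (f := fun j => v j 0) (t := Finset.univ) (by simp)]
      push_cast; rfl
    rw [hcard, Finset.sum_mul]
    refine Finset.sum_le_sum fun a _ => mul_le_mul_of_nonneg_left ?_ (Nat.cast_nonneg _)
    have hle : √q ^ n * ∑ j ∈ J.filter (fun j => v j 0 = a), |√(P.prob r a) * t j|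
        ≤ √q ^ (n + 1) * ∑ j ∈ J, |t j| := by
      rw [pow_succ, mul_assoc]
      refine mul_le_mul_of_nonneg_left ?_ (by positivity)
      rw [Finset.mul_sum]
      refine (Finset.sum_le_sum_of_subset_of_nonneg (Finset.filter_subset _ _)
        fun _ _ _ => abs_nonneg _).trans (Finset.sum_le_sum fun j _ => ?_)
      rw [abs_mul, abs_of_nonneg (Real.sqrt_nonneg _)]
      exact mul_le_mul_of_nonneg_right (Real.sqrt_le_sqrt (hq r a)) (abs_nonneg _)
    have h0 : 0 ≤ √q ^ n * ∑ j ∈ J.filter (fun j => v j 0 = a), |√(P.prob r a) * t j| := by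
      positivity
    exact Finset.sum_le_sum fun c _ =>
      add_le_add (charModulus_mono h0 hle) (charModulus_mono h0 hle)

/-- The fixed-point system has at most one solution, without any moment condition. -/
theorem SolvesFixedPointSystem.unique {X Y : Fin b → ProbabilityMeasure (PathSpace b)}
    (hX : P.SolvesFixedPointSystem X) (hY : P.SolvesFixedPointSystem Y) : X = Y := by
  obtain ⟨q, hq0, hq1, hq⟩ := P.exists_bound
  funext r
  refine Subtype.ext ?_
  change (X r : Measure (PathSpace b)) = Y r
  refine PathSpace.ext_of_jointCharFun fun J t => ?_
  have hlim : Filter.Tendsto (fun n : ℕ => √q ^ n * ∑ j ∈ J, |t j|) Filter.atTop (𝓝 0) := by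
    have := (tendsto_pow_atTop_nhds_zero_of_lt_one (Real.sqrt_nonneg q)
      ((Real.sqrt_lt' one_pos).2 (by simpa using hq1))).mul_const (∑ j ∈ J, |t j|)
    simpa using this
  have hnn (n : ℕ) : 0 ≤ √q ^ n * ∑ j ∈ J, |t j| :=
    mul_nonneg (by positivity) (Finset.sum_nonneg fun _ _ => abs_nonneg _)
  have hlim2 : Filter.Tendsto (fun n : ℕ => (J.card : ℝ) *
      ∑ a, (charModulus (X a : Measure (PathSpace b)) (√q ^ n * ∑ j ∈ J, |t j|)
          + charModulus (Y a : Measure (PathSpace b)) (√q ^ n * ∑ j ∈ J, |t j|)))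
      Filter.atTop (𝓝 0) := by
    have := (tendsto_finsetSum (Finset.univ : Finset (Fin b)) fun a _ =>
      (tendsto_charModulus (ν := (X a : Measure (PathSpace b))) hnn hlim).add
        (tendsto_charModulus (ν := (Y a : Measure (PathSpace b))) hnn hlim)).const_mul
          (J.card : ℝ)
    simpa using this
  have := ge_of_tendsto' hlim2 fun n => P.norm_jointCharFun_sub_le hX hY hq n r J t id
  exact sub_eq_zero.1 (norm_le_zero_iff.1 this)

end TransitionMatrix

/-! ### Strings and truncated coincidences -/

/-- The string `w` with the letter `a` put in front. -/
def InfString.cons {b : ℕ} (a : Fin b) (w : InfString b) : InfString b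
  | 0 => a
  | n + 1 => w n

lemma InfString.measurable_cons {b : ℕ} (a : Fin b) : Measurable (InfString.cons a) :=
  measurable_pi_lambda _ fun n => by
    cases n with
    | zero => exact measurable_const
    | succ n => exact measurable_pi_apply n

lemma InfString.cons_mem_cylinder_succ {b : ℕ} (a : Fin b) (v w : InfString b) (k : ℕ) :
    InfString.cons a w ∈ PiNat.cylinder v (k + 1) ↔ a = v 0 ∧ w ∈ PiNat.cylinder v.tail k := by
  simp only [PiNat.mem_cylinder_iff]
  constructor
  · exact fun h => ⟨h 0 (Nat.succ_pos k), fun i hi => h (i + 1) (by omega)⟩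
  · rintro ⟨h0, h⟩ (_ | i) hi
    · exact h0
    · exact h i (by omega)

lemma InfString.measurableSet_cylinder {b : ℕ} (v : InfString b) (k : ℕ) :
    MeasurableSet (PiNat.cylinder v k) := by
  rw [PiNat.cylinder_eq_pi]
  exact MeasurableSet.pi (Finset.countable_toSet _) fun i _ => measurableSet_singleton _

/-- The length of the longest common prefix, cut off at `n`, as a sum of indicators of
cylinders. For equal strings it is `n`, whereas `(coincidence v v).toNat` is the junk value `0`. -/
def truncCoincidence {b : ℕ} (n : ℕ) (v s : InfString b) : ℝ :=
  ∑ k ∈ Finset.range n, (PiNat.cylinder v (k + 1)).indicator (fun _ => (1 : ℝ)) s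

section truncCoincidence

variable {b : ℕ} (n : ℕ) (v : InfString b)

lemma measurable_truncCoincidence : Measurable (truncCoincidence n v) :=
  Finset.measurable_sum _ fun k _ =>
    measurable_const.indicator (InfString.measurableSet_cylinder v (k + 1))

lemma truncCoincidence_eq_min {v s : InfString b} (h : v ≠ s) :
    truncCoincidence n v s = (min n (coincidence v s).toNat : ℕ) := by
  classical
  have h1 (k : ℕ) : s ∈ PiNat.cylinder v (k + 1) ↔ k < PiNat.firstDiff v s := by
    rw [PiNat.mem_cylinder_comm, PiNat.mem_cylinder_iff_le_firstDiff h, Nat.succ_le_iff]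
  simp only [truncCoincidence, Set.indicator_apply, h1, coincidence, if_neg h, ENat.toNat_natCast,
    Finset.sum_boole]
  congr 1
  have : (Finset.range n).filter (fun k => k < PiNat.firstDiff v s)
      = Finset.range (min n (PiNat.firstDiff v s)) := by
    ext k; simp
  rw [this, Finset.card_range]

lemma tendsto_truncCoincidence {v s : InfString b} (h : v ≠ s) :
    Filter.Tendsto (fun n => truncCoincidence n v s) Filter.atTop
      (𝓝 ((coincidence v s).toNat : ℝ)) := by
  refine tendsto_const_nhds.congr' ?_
  filter_upwards [Filter.eventually_ge_atTop (coincidence v s).toNat] with n hn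
  rw [truncCoincidence_eq_min n h, min_eq_right hn]

lemma truncCoincidence_nonneg (s : InfString b) : 0 ≤ truncCoincidence n v s :=
  Finset.sum_nonneg fun _ _ => Set.indicator_nonneg (fun _ _ => zero_le_one) _

lemma truncCoincidence_le {v s : InfString b} (h : v ≠ s) :
    truncCoincidence n v s ≤ ((coincidence v s).toNat : ℝ) := by
  rw [truncCoincidence_eq_min n h]
  exact_mod_cast min_le_right _ _

lemma truncCoincidence_cons (a : Fin b) (s : InfString b) :
    truncCoincidence (n + 1) v (InfString.cons a s)
      = if a = v 0 then 1 + truncCoincidence n v.tail s else 0 := by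
  classical
  by_cases ha : a = v 0
  · rw [if_pos ha, truncCoincidence, Finset.sum_range_succ', add_comm, truncCoincidence]
    congr 1
    · rw [Set.indicator_of_mem]
      rw [InfString.cons_mem_cylinder_succ]
      simp [ha]
    · refine Finset.sum_congr rfl fun k _ => ?_
      simp only [Set.indicator_apply, InfString.cons_mem_cylinder_succ, ha, true_and]
  · rw [if_neg ha, truncCoincidence]
    refine Finset.sum_eq_zero fun k _ => ?_
    rw [Set.indicator_apply, if_neg]
    exact fun h => ha ((InfString.cons_mem_cylinder_succ _ _ _ _).1 h).1

end truncCoincidence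

namespace TransitionMatrix

variable {b : ℕ} (P : TransitionMatrix b)

/-! ### Prefix probabilities of the Markov source -/

lemma prefixProb_succ (r : Fin b) (v : InfString b) (k : ℕ) :
    P.prefixProb (P.prob r) v (k + 1)
      = P.prob r (v 0) * P.prefixProb (P.prob (v 0)) v.tail k := by
  cases k with
  | zero => simp [prefixProb]
  | succ k =>
    simp only [prefixProb]
    rw [Finset.prod_range_succ', mul_comm (∏ k ∈ Finset.range k, _)]
    rfl

lemma prefixProb_nonneg (r : Fin b) (v : InfString b) (k : ℕ) :
    0 ≤ P.prefixProb (P.prob r) v k := by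
  cases k with
  | zero => simp [prefixProb]
  | succ k =>
    exact mul_nonneg (P.pos _ _).le (Finset.prod_nonneg fun _ _ => (P.pos _ _).le)

lemma prefixProb_le {q : ℝ} (hq : ∀ i j, P.prob i j ≤ q) (r : Fin b) (v : InfString b) (k : ℕ) :
    P.prefixProb (P.prob r) v k ≤ q ^ k := by
  induction k generalizing r v with
  | zero => simp [prefixProb]
  | succ k ih =>
    rw [prefixProb_succ, pow_succ']
    exact mul_le_mul (hq _ _) (ih _ _) (P.prefixProb_nonneg _ _ _)
      ((P.pos r r).le.trans (hq r r))

lemma summable_prefixProb (r : Fin b) (v : InfString b) :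
    Summable (P.prefixProb (P.prob r) v) := by
  obtain ⟨q, hq0, hq1, hq⟩ := P.exists_bound
  exact Summable.of_nonneg_of_le (P.prefixProb_nonneg r v) (P.prefixProb_le hq r v)
    (summable_geometric_of_lt_one hq0 hq1)

lemma sourceLaw_eq_trajMeasure (μ : Fin b → ℝ) :
    P.sourceLaw μ = Kernel.trajMeasure (X := fun _ => Fin b) (letterLaw μ) P.stepKernel := rfl

instance isProbabilityMeasure_sourceLaw (r : Fin b) :
    IsProbabilityMeasure (P.sourceLaw (P.prob r)) := by
  rw [sourceLaw_eq_trajMeasure]; infer_instance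

lemma sourceLaw_map_eval_zero (r : Fin b) :
    (P.sourceLaw (P.prob r)).map (fun s => s 0) = letterLaw (P.prob r) := by
  have h0 : (fun s : InfString b => s 0) = (fun y : (_i : Finset.Iic 0) → Fin b =>
    y ⟨0, by simp⟩) ∘ Preorder.frestrictLe 0 := rfl
  rw [h0, ← Measure.map_map (by fun_prop) (by fun_prop), sourceLaw,
    Measure.map_comp _ _ (by fun_prop), Kernel.traj_map_frestrictLe, Kernel.partialTraj_self,
    Measure.id_comp, Measure.map_map (by fun_prop) (by fun_prop)]
  exact Measure.map_id

lemma sourceLaw_cylinder (r : Fin b) (v : InfString b) (k : ℕ) :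
    P.sourceLaw (P.prob r) (PiNat.cylinder v k)
      = ENNReal.ofReal (P.prefixProb (P.prob r) v k) := by
  rcases k with _ | k
  · simp [prefixProb]
  induction k with
  | zero =>
    have h : PiNat.cylinder v 1 = (fun s : InfString b => s 0) ⁻¹' {v 0} := by
      ext s; simp [PiNat.mem_cylinder_iff]
    rw [h, ← Measure.map_apply (by fun_prop) (measurableSet_singleton _),
      sourceLaw_map_eval_zero, letterLaw_singleton]
    simp [prefixProb]
  | succ k ih =>
    have hset (m : ℕ) : PiNat.cylinder v (m + 1)
        = Preorder.frestrictLe (π := fun _ => Fin b) m ⁻¹' {Preorder.frestrictLe m v} := by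
      ext s
      simp only [PiNat.mem_cylinder_iff, Set.mem_preimage, Set.mem_singleton_iff, funext_iff,
        Preorder.frestrictLe_apply, Subtype.forall, Finset.mem_Iic, Nat.lt_succ_iff]
    have hset2 : PiNat.cylinder v (k + 1 + 1)
        = (fun s : InfString b => (Preorder.frestrictLe (π := fun _ => Fin b) k s, s (k + 1))) ⁻¹'
          ({Preorder.frestrictLe k v} ×ˢ {v (k + 1)}) := by
      ext s
      have h1 := Set.ext_iff.1 (hset k) s
      simp only [Set.mem_preimage, Set.mem_singleton_iff, Set.mem_prod] at h1 ⊢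
      rw [← h1]
      simp only [PiNat.mem_cylinder_iff]
      exact ⟨fun h => ⟨fun i hi => h i (by omega), h _ (by omega)⟩, fun h i hi => by
        rcases Nat.lt_succ_iff_lt_or_eq.1 hi with h2 | rfl
        · exact h.1 i h2
        · exact h.2⟩
    have hmap : (P.sourceLaw (P.prob r)).map (Preorder.frestrictLe (π := fun _ => Fin b) k)
        {Preorder.frestrictLe k v} = ENNReal.ofReal (P.prefixProb (P.prob r) v (k + 1)) := by
      rw [Measure.map_apply (by fun_prop) (measurableSet_singleton _), ← hset, ih]
    rw [hset2, ← Measure.map_apply (by fun_prop)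
      ((measurableSet_singleton _).prod (measurableSet_singleton _)), sourceLaw_eq_trajMeasure,
      ← Kernel.map_frestrictLe_trajMeasure_compProd_eq_map_trajMeasure,
      Measure.compProd_apply_prod (measurableSet_singleton _) (measurableSet_singleton _),
      lintegral_singleton, ← sourceLaw_eq_trajMeasure, hmap, stepKernel_apply,
      letterLaw_singleton, ← ENNReal.ofReal_mul (P.pos _ _).le]
    congr 1
    simp only [prefixProb, Finset.prod_range_succ, Preorder.frestrictLe_apply]
    ring

lemma real_sourceLaw_cylinder (r : Fin b) (v : InfString b) (k : ℕ) :
    (P.sourceLaw (P.prob r)).real (PiNat.cylinder v k) = P.prefixProb (P.prob r) v k := by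
  rw [measureReal_def, sourceLaw_cylinder, ENNReal.toReal_ofReal (P.prefixProb_nonneg _ _ _)]

/-- The first letter is drawn from row `r`; given that it is `a`, the remaining string is produced
by the source started from row `a`. -/
lemma sourceLaw_eq_sum (r : Fin b) :
    P.sourceLaw (P.prob r) = ∑ a, ENNReal.ofReal (P.prob r a) •
      (P.sourceLaw (P.prob a)).map (InfString.cons a) := by
  set ν := ∑ a, ENNReal.ofReal (P.prob r a) •
    (P.sourceLaw (P.prob a)).map (InfString.cons a) with hν
  have hcyl (v : InfString b) (k : ℕ) : ν (PiNat.cylinder v (k + 1))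
      = ENNReal.ofReal (P.prefixProb (P.prob r) v (k + 1)) := by
    simp only [hν, Measure.finsetSum_apply, Measure.smul_apply, smul_eq_mul]
    rw [Finset.sum_eq_single (v 0)]
    · rw [Measure.map_apply (InfString.measurable_cons _) (InfString.measurableSet_cylinder _ _)]
      have : InfString.cons (v 0) ⁻¹' PiNat.cylinder v (k + 1) = PiNat.cylinder v.tail k := by
        ext s; simp only [Set.mem_preimage, InfString.cons_mem_cylinder_succ, true_and]
      rw [this, sourceLaw_cylinder, prefixProb_succ, ENNReal.ofReal_mul (P.pos _ _).le]
    · intro a _ ha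
      rw [Measure.map_apply (InfString.measurable_cons _) (InfString.measurableSet_cylinder _ _)]
      have : InfString.cons a ⁻¹' PiNat.cylinder v (k + 1) = ∅ := by
        ext s
        simp only [Set.mem_preimage, InfString.cons_mem_cylinder_succ, ha, false_and,
          Set.mem_empty_iff_false]
      rw [this]; simp
    · simp
  have hfin : IsFiniteMeasure ν := by
    refine ⟨?_⟩
    simp only [hν, Measure.finsetSum_apply, Measure.smul_apply, smul_eq_mul]
    refine ENNReal.sum_lt_top.2 fun a _ => ENNReal.mul_lt_top ENNReal.ofReal_lt_top ?_
    rw [Measure.map_apply (InfString.measurable_cons _) .univ]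
    exact measure_lt_top _ _
  have hproj := isProjectiveMeasureFamily_map_restrict (P := ν)
    (X := fun n (s : InfString b) => s n) fun n => (measurable_pi_apply n).aemeasurable
  refine IsProjectiveLimit.unique ((isProjectiveLimit_nat_iff hproj _).2 fun n => ?_)
    (fun I => rfl)
  refine Measure.ext_of_singleton fun x => ?_
  rw [Measure.map_apply (by fun_prop) (measurableSet_singleton _),
    Measure.map_apply (by fun_prop) (measurableSet_singleton _)]
  let v : InfString b := fun i => x ⟨min i n, by simp⟩
  have hx : (Preorder.frestrictLe (π := fun _ => Fin b) n) ⁻¹' {x} = PiNat.cylinder v (n + 1) := by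
    ext s
    simp only [PiNat.mem_cylinder_iff, Set.mem_preimage, Set.mem_singleton_iff, funext_iff,
      Preorder.frestrictLe_apply, Subtype.forall, Finset.mem_Iic, Nat.lt_succ_iff]
    refine forall₂_congr fun i hi => ?_
    have : v i = x ⟨i, Finset.mem_Iic.2 hi⟩ := by simp only [v, min_eq_left hi]
    rw [this]
  have hx' : (fun s : InfString b => (Finset.Iic n).restrict (fun i => s i)) ⁻¹' {x}
      = PiNat.cylinder v (n + 1) := hx
  rw [hx, hx', sourceLaw_cylinder, hcyl]

/-- The source law has no atoms, so the strings with an infinite coincidence, where `toNat` takes a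
junk value, are negligible. -/
lemma ae_ne_sourceLaw (r : Fin b) (v : InfString b) :
    ∀ᵐ s ∂(P.sourceLaw (P.prob r)), v ≠ s := by
  obtain ⟨q, hq0, hq1, hq⟩ := P.exists_bound
  have h0 : P.sourceLaw (P.prob r) {v} = 0 := by
    refine le_antisymm ?_ zero_le
    have hlim : Filter.Tendsto (fun k : ℕ => ENNReal.ofReal (q ^ k)) Filter.atTop (𝓝 0) := by
      simpa using ENNReal.tendsto_ofReal (tendsto_pow_atTop_nhds_zero_of_lt_one hq0 hq1)
    refine ge_of_tendsto' hlim fun k => ?_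
    refine (measure_mono (t := PiNat.cylinder v k) (by simp)).trans ?_
    rw [sourceLaw_cylinder]
    exact ENNReal.ofReal_le_ofReal (P.prefixProb_le hq r v k)
  rw [ae_iff]
  convert h0 using 2
  ext s; simp [eq_comm]

/-! ### Moments of the coincidence with a random string -/

lemma aestronglyMeasurable_coincidence (r : Fin b) (v : InfString b) :
    AEStronglyMeasurable (fun s => ((coincidence v s).toNat : ℝ)) (P.sourceLaw (P.prob r)) :=
  aestronglyMeasurable_of_tendsto_ae Filter.atTop
    (fun n => (measurable_truncCoincidence n v).aestronglyMeasurable)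
    ((P.ae_ne_sourceLaw r v).mono fun _ hs => tendsto_truncCoincidence hs)

/-- In `L²`, the indicator of the event that the random string shares `k` letters with `v` has norm
at most `√q ^ k`, and these norms are summable. -/
lemma memLp_coincidence (r : Fin b) (v : InfString b) :
    MemLp (fun s => ((coincidence v s).toNat : ℝ)) 2 (P.sourceLaw (P.prob r)) := by
  refine ⟨P.aestronglyMeasurable_coincidence r v, ?_⟩
  obtain ⟨q, hq0, hq1, hq⟩ := P.exists_bound
  have hsum : Summable fun k : ℕ => √q ^ (k + 1) :=
    (summable_nat_add_iff 1).2 (summable_geometric_of_lt_one (Real.sqrt_nonneg q)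
      ((Real.sqrt_lt' one_pos).2 (by simpa using hq1)))
  refine lt_of_le_of_lt (Lp.eLpNorm_lim_le_liminf_eLpNorm
    (fun n => (measurable_truncCoincidence n v).aestronglyMeasurable) _
    ((P.ae_ne_sourceLaw r v).mono fun _ hs => tendsto_truncCoincidence hs)) ?_
  refine lt_of_le_of_lt (Filter.liminf_le_of_le (hf := by isBoundedDefault) (a :=
    ENNReal.ofReal (∑' k : ℕ, √q ^ (k + 1))) fun c hc => ?_) ENNReal.ofReal_lt_top
  obtain ⟨n, hn⟩ := hc.exists
  refine hn.trans ?_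
  have heq : truncCoincidence n v = ∑ k ∈ Finset.range n,
      (PiNat.cylinder v (k + 1)).indicator (fun _ => (1 : ℝ)) := by
    ext s; simp [truncCoincidence]
  rw [heq]
  refine (eLpNorm_sum_le (fun k _ => (measurable_const.indicator
    (InfString.measurableSet_cylinder v (k + 1))).aestronglyMeasurable) (by norm_num)).trans ?_
  refine le_trans (Finset.sum_le_sum (g := fun k => ENNReal.ofReal (√q ^ (k + 1)))
    fun k _ => ?_) ?_
  · rw [eLpNorm_indicator_const (InfString.measurableSet_cylinder _ _) (by norm_num) (by norm_num),
      sourceLaw_cylinder, ENNReal.ofReal_rpow_of_nonneg (P.prefixProb_nonneg _ _ _) (by norm_num)]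
    simp only [enorm_one, one_mul, ENNReal.toReal_ofNat, ← Real.sqrt_eq_rpow]
    refine ENNReal.ofReal_le_ofReal ?_
    refine Real.sqrt_le_iff.2 ⟨by positivity, (P.prefixProb_le hq _ _ _).trans_eq ?_⟩
    rw [← pow_mul, mul_comm, pow_mul, Real.sq_sqrt hq0]
  · rw [← ENNReal.ofReal_sum_of_nonneg fun k _ => by positivity]
    exact ENNReal.ofReal_le_ofReal (hsum.sum_le_tsum _ fun k _ => by positivity)

lemma integrable_coincidence (r : Fin b) (v : InfString b) :
    Integrable (fun s => ((coincidence v s).toNat : ℝ)) (P.sourceLaw (P.prob r)) :=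
  (P.memLp_coincidence r v).integrable (by norm_num)

lemma tendsto_integral_truncCoincidence (r : Fin b) (v : InfString b) :
    Filter.Tendsto (fun n => ∫ s, truncCoincidence n v s ∂(P.sourceLaw (P.prob r))) Filter.atTop
      (𝓝 (∫ s, ((coincidence v s).toNat : ℝ) ∂(P.sourceLaw (P.prob r)))) := by
  refine tendsto_integral_of_dominated_convergence _
    (fun n => (measurable_truncCoincidence n v).aestronglyMeasurable)
    (P.integrable_coincidence r v) (fun n => ?_)
    ((P.ae_ne_sourceLaw r v).mono fun _ hs => tendsto_truncCoincidence hs)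
  filter_upwards [P.ae_ne_sourceLaw r v] with s hs
  rw [Real.norm_of_nonneg (truncCoincidence_nonneg n v s)]
  exact truncCoincidence_le n hs

lemma tendsto_integral_truncCoincidence_mul (r : Fin b) (v w : InfString b) :
    Filter.Tendsto (fun n => ∫ s, truncCoincidence n v s * truncCoincidence n w s
      ∂(P.sourceLaw (P.prob r))) Filter.atTop
      (𝓝 (∫ s, ((coincidence v s).toNat : ℝ) * ((coincidence w s).toNat : ℝ)
        ∂(P.sourceLaw (P.prob r)))) := by
  refine tendsto_integral_of_dominated_convergence _
    (fun n => ((measurable_truncCoincidence n v).mul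
      (measurable_truncCoincidence n w)).aestronglyMeasurable)
    ((P.memLp_coincidence r v).integrable_mul (P.memLp_coincidence r w)) (fun n => ?_) ?_
  · filter_upwards [P.ae_ne_sourceLaw r v, P.ae_ne_sourceLaw r w] with s hs hs'
    rw [Real.norm_of_nonneg (mul_nonneg (truncCoincidence_nonneg n v s)
      (truncCoincidence_nonneg n w s))]
    exact mul_le_mul (truncCoincidence_le n hs) (truncCoincidence_le n hs')
      (truncCoincidence_nonneg n w s) (Nat.cast_nonneg _)
  · filter_upwards [P.ae_ne_sourceLaw r v, P.ae_ne_sourceLaw r w] with s hs hs'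
    exact (tendsto_truncCoincidence hs).mul (tendsto_truncCoincidence hs')

lemma one_add_integral_coincidence (r : Fin b) (v : InfString b) :
    1 + ∫ s, ((coincidence v s).toNat : ℝ) ∂(P.sourceLaw (P.prob r))
      = P.meanFun (P.prob r) v := by
  have h1 := (P.tendsto_integral_truncCoincidence r v).const_add 1
  refine tendsto_nhds_unique h1 ?_
  have h2 := ((Filter.tendsto_add_atTop_iff_nat 1).2
    (P.summable_prefixProb r v).hasSum.tendsto_sum_nat)
  refine h2.congr fun n => ?_
  rw [Finset.sum_range_succ', add_comm]
  congr 1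
  simp only [truncCoincidence]
  rw [integral_finsetSum _ fun k _ => (integrable_const _).indicator
    (InfString.measurableSet_cylinder _ _)]
  refine Finset.sum_congr rfl fun k _ => ?_
  rw [integral_indicator_const _ (InfString.measurableSet_cylinder _ _), real_sourceLaw_cylinder]
  simp

lemma coincidence_cons_ae (r a : Fin b) (v : InfString b) :
    ∀ᵐ s ∂(P.sourceLaw (P.prob r)), ((coincidence v (InfString.cons a s)).toNat : ℝ)
      = if a = v 0 then 1 + ((coincidence v.tail s).toNat : ℝ) else 0 := by
  filter_upwards [P.ae_ne_sourceLaw r v.tail] with s hs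
  have hne : v ≠ InfString.cons a s := fun h => hs (by rw [h]; rfl)
  have h1 := (Filter.tendsto_add_atTop_iff_nat 1).2 (tendsto_truncCoincidence hne)
  refine tendsto_nhds_unique h1 ?_
  simp only [truncCoincidence_cons]
  split_ifs with ha
  · exact (tendsto_truncCoincidence hs).const_add 1
  · exact tendsto_const_nhds

lemma integral_sourceLaw (r : Fin b) {F : InfString b → ℝ}
    (hF : Integrable F (P.sourceLaw (P.prob r))) :
    ∫ s, F s ∂(P.sourceLaw (P.prob r))
      = ∑ a, P.prob r a * ∫ s, F (InfString.cons a s) ∂(P.sourceLaw (P.prob a)) := by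
  have hF' := hF
  rw [P.sourceLaw_eq_sum r] at hF'
  have hFa (a : Fin b) : Integrable F (ENNReal.ofReal (P.prob r a) •
      (P.sourceLaw (P.prob a)).map (InfString.cons a)) :=
    (integrable_finsetSum_measure.1 hF') a (Finset.mem_univ a)
  rw [P.sourceLaw_eq_sum r, integral_finsetSum_measure fun a _ => hFa a]
  refine Finset.sum_congr rfl fun a _ => ?_
  have hne : ENNReal.ofReal (P.prob r a) ≠ 0 := by simpa using P.pos r a
  rw [integral_smul_measure, ENNReal.toReal_ofReal (P.pos r a).le,
    integral_map (InfString.measurable_cons a).aemeasurable, smul_eq_mul]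
  exact ((integrable_smul_measure hne ENNReal.ofReal_ne_top).1 (hFa a)).1

/-- The covariance of the coincidences of `v` and of `w` with a random string from the source
started from row `r`. -/
def coincidenceCov (r : Fin b) (v w : InfString b) : ℝ :=
  cov[fun s => ((coincidence v s).toNat : ℝ), fun s => ((coincidence w s).toNat : ℝ);
    P.sourceLaw (P.prob r)]

lemma coincidenceCov_eq (r : Fin b) (v w : InfString b) : P.coincidenceCov r v w
    = (∫ s, ((coincidence v s).toNat : ℝ) * ((coincidence w s).toNat : ℝ)
        ∂(P.sourceLaw (P.prob r)))
      - (∫ s, ((coincidence v s).toNat : ℝ) ∂(P.sourceLaw (P.prob r)))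
        * ∫ s, ((coincidence w s).toNat : ℝ) ∂(P.sourceLaw (P.prob r)) := by
  rw [coincidenceCov, covariance_eq_sub (P.memLp_coincidence r v) (P.memLp_coincidence r w)]
  rfl

lemma integral_coincidence (r : Fin b) (v : InfString b) :
    ∫ s, ((coincidence v s).toNat : ℝ) ∂(P.sourceLaw (P.prob r))
      = P.prob r (v 0) * P.meanFun (P.prob (v 0)) v.tail := by
  rw [P.integral_sourceLaw r (P.integrable_coincidence r v), Finset.sum_eq_single (v 0)]
  · rw [integral_congr_ae (P.coincidence_cons_ae (v 0) (v 0) v)]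
    simp only [if_true]
    rw [integral_add (integrable_const _) (P.integrable_coincidence _ _)]
    simp [one_add_integral_coincidence]
  · intro a _ ha
    rw [integral_congr_ae (P.coincidence_cons_ae a a v)]
    simp [ha]
  · simp

/-- The covariance function of the limit satisfies the recursion that the fixed-point equation
imposes on covariances. -/
lemma coincidenceCov_recursion (r : Fin b) (v w : InfString b) :
    P.coincidenceCov r v w
      = (∑ a, if v 0 = a ∧ w 0 = a then P.prob r a * P.coincidenceCov a v.tail w.tail else 0)
        + P.meanFun (P.prob (v 0)) v.tail * P.meanFun (P.prob (w 0)) w.tail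
          * P.noiseCov r (v 0) (w 0) := by
  have key : ∫ s, ((coincidence v s).toNat : ℝ) * ((coincidence w s).toNat : ℝ)
        ∂(P.sourceLaw (P.prob r))
      = ∑ a, if v 0 = a ∧ w 0 = a then P.prob r a * (P.coincidenceCov a v.tail w.tail
        + P.meanFun (P.prob a) v.tail * P.meanFun (P.prob a) w.tail) else 0 := by
    rw [P.integral_sourceLaw r (F := fun s =>
      ((coincidence v s).toNat : ℝ) * ((coincidence w s).toNat : ℝ))
      ((P.memLp_coincidence r v).integrable_mul (P.memLp_coincidence r w))]
    refine Finset.sum_congr rfl fun a _ => ?_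
    have hae : ∀ᵐ s ∂(P.sourceLaw (P.prob a)),
        ((coincidence v (InfString.cons a s)).toNat : ℝ)
          * ((coincidence w (InfString.cons a s)).toNat : ℝ)
        = if v 0 = a ∧ w 0 = a then 1 + ((coincidence v.tail s).toNat : ℝ)
          + (((coincidence w.tail s).toNat : ℝ)
          + ((coincidence v.tail s).toNat : ℝ) * ((coincidence w.tail s).toNat : ℝ)) else 0 := by
      filter_upwards [P.coincidence_cons_ae a a v, P.coincidence_cons_ae a a w] with s h1 h2
      rw [h1, h2]
      simp only [eq_comm (a := a)]
      by_cases hv : v 0 = a <;> by_cases hw : w 0 = a <;> simp only [hv, hw, if_true, if_false,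
        and_true, and_false, mul_zero, zero_mul]
      ring
    rw [integral_congr_ae hae]
    split_ifs with h
    · have hi := P.integrable_coincidence a v.tail
      have hi' := P.integrable_coincidence a w.tail
      have hm : Integrable (fun s => ((coincidence v.tail s).toNat : ℝ)
          * ((coincidence w.tail s).toNat : ℝ)) (P.sourceLaw (P.prob a)) :=
        (P.memLp_coincidence a v.tail).integrable_mul (P.memLp_coincidence a w.tail)
      have h1 : Integrable (fun s => 1 + ((coincidence v.tail s).toNat : ℝ))
          (P.sourceLaw (P.prob a)) := (integrable_const _).add hi
      have h2 : Integrable (fun s => ((coincidence w.tail s).toNat : ℝ)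
          + ((coincidence v.tail s).toNat : ℝ) * ((coincidence w.tail s).toNat : ℝ))
          (P.sourceLaw (P.prob a)) := hi'.add hm
      rw [integral_add h1 h2, integral_add (integrable_const _) hi, integral_add hi' hm,
        coincidenceCov_eq, ← one_add_integral_coincidence, ← one_add_integral_coincidence]
      simp only [integral_const, probReal_univ, smul_eq_mul]
      ring
    · simp
  rw [coincidenceCov_eq, key, integral_coincidence, integral_coincidence]
  by_cases hvw : v 0 = w 0
  · have h1 (a : Fin b) (x : ℝ) :
        (if v 0 = a ∧ w 0 = a then x else 0) = if v 0 = a then x else 0 := by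
      by_cases h : v 0 = a <;> simp [h, ← hvw]
    simp only [h1, Finset.sum_ite_eq, Finset.mem_univ, if_true, noiseCov]
    rw [← hvw, if_pos rfl]
    ring
  · have h1 (a : Fin b) (x : ℝ) : (if v 0 = a ∧ w 0 = a then x else 0) = 0 :=
      if_neg fun h => hvw (h.1.trans h.2.symm)
    simp only [h1, Finset.sum_const_zero, noiseCov, if_neg hvw]
    ring

end TransitionMatrix

/-! ### Characteristic functions of the limit laws -/

namespace TransitionMatrix

variable {b : ℕ} (P : TransitionMatrix b)

/-- The variance of `∑ t j * H (v j)` for the limit process `H` started from row `r`. -/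
def coincidenceForm {ι : Type*} (r : Fin b) (J : Finset ι) (t : ι → ℝ) (v : ι → InfString b) : ℝ :=
  ∑ j ∈ J, ∑ k ∈ J, t j * t k * P.coincidenceCov r (v j) (v k)

lemma jointCharFun_of_isLimitLaw {r : Fin b} {H : ProbabilityMeasure (PathSpace b)}
    (hH : P.IsLimitLaw (P.prob r) H) {ι : Type*} (J : Finset ι) (t : ι → ℝ)
    (v : ι → InfString b) :
    jointCharFun (H : Measure (PathSpace b)) J t v
      = Complex.exp (-(P.coincidenceForm r J t v : ℝ) / 2) := by
  have hG := ((hH.gaussian.comp_right v).smul t).hasGaussianLaw_fun_sum (I := J)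
  simp only [Function.comp_apply, smul_eq_mul] at hG
  have hL2 (w : InfString b) : MemLp (fun f : PathSpace b => f w) 2 (H : Measure (PathSpace b)) :=
    (hH.gaussian.hasGaussianLaw_eval w).memLp_two
  have hmean : ∫ f : PathSpace b, ∑ j ∈ J, t j * f (v j) ∂(H : Measure (PathSpace b)) = 0 := by
    rw [integral_finsetSum _ fun j _ => ((hL2 (v j)).integrable (by norm_num)).const_mul _]
    simp [integral_const_mul, hH.centered]
  have hvar : Var[fun f : PathSpace b => ∑ j ∈ J, t j * f (v j); (H : Measure (PathSpace b))]
      = P.coincidenceForm r J t v := by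
    rw [variance_of_integral_eq_zero hG.aemeasurable hmean]
    have hint (j k : ι) : Integrable (fun f : PathSpace b => t j * t k * (f (v j) * f (v k)))
        (H : Measure (PathSpace b)) := ((hL2 (v j)).integrable_mul (hL2 (v k))).const_mul _
    have hsq (f : PathSpace b) : (∑ j ∈ J, t j * f (v j)) ^ 2
        = ∑ j ∈ J, ∑ k ∈ J, t j * t k * (f (v j) * f (v k)) := by
      rw [sq, Finset.sum_mul_sum]
      exact Finset.sum_congr rfl fun j _ => Finset.sum_congr rfl fun k _ => by ring
    simp_rw [hsq]
    rw [integral_finsetSum _ fun j _ => integrable_finsetSum _ fun k _ => hint j k]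
    refine Finset.sum_congr rfl fun j _ => ?_
    rw [integral_finsetSum _ fun k _ => hint j k]
    refine Finset.sum_congr rfl fun k _ => ?_
    rw [integral_const_mul, hH.covariance, coincidenceCov]
  have h := hG.charFun_map_eq 1
  rw [charFun_apply, integral_map hG.aemeasurable (by fun_prop)] at h
  simp only [RCLike.inner_apply, map_one, mul_one, one_mul, hmean, hvar, conj_trivial] at h
  rw [jointCharFun, h]
  congr 1
  simp [neg_div]

/-- The nonnegativity of the form need not be assumed: it follows because characteristic functions
are bounded by `1`. -/
lemma map_sum_eval_eq_gaussianReal {r : Fin b} {ν : Measure (PathSpace b)} [IsProbabilityMeasure ν]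
    (h : ∀ {ι : Type} (J : Finset ι) (t : ι → ℝ) (v : ι → InfString b),
      jointCharFun ν J t v = Complex.exp (-(P.coincidenceForm r J t v : ℝ) / 2))
    {ι : Type} (J : Finset ι) (t : ι → ℝ) (v : ι → InfString b) :
    0 ≤ P.coincidenceForm r J t v ∧
    ν.map (fun f => ∑ j ∈ J, t j * f (v j))
      = gaussianReal 0 (P.coincidenceForm r J t v).toNNReal := by
  have h0 : 0 ≤ P.coincidenceForm r J t v := by
    have h1 := norm_integral_expI_le_one (μ := ν) fun f => ∑ j ∈ J, t j * f (v j)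
    change ‖jointCharFun ν J t v‖ ≤ 1 at h1
    rw [h, Complex.norm_exp] at h1
    have h2 : (-(P.coincidenceForm r J t v : ℂ) / 2).re = -(P.coincidenceForm r J t v) / 2 := by
      have : (-(P.coincidenceForm r J t v : ℂ) / 2)
        = ((-(P.coincidenceForm r J t v) / 2 : ℝ) : ℂ) := by push_cast; ring
      rw [this, Complex.ofReal_re]
    rw [h2, Real.exp_le_one_iff] at h1
    linarith
  refine ⟨h0, ?_⟩
  have : IsProbabilityMeasure (ν.map fun f => ∑ j ∈ J, t j * f (v j)) :=
    Measure.isProbabilityMeasure_map (PathSpace.measurable_sum_eval J t v).aemeasurable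
  refine Measure.ext_of_charFun ?_
  ext s
  rw [charFun_gaussianReal, charFun_apply,
    integral_map (PathSpace.measurable_sum_eval J t v).aemeasurable (by fun_prop)]
  have h1 := h J (fun j => s * t j) v
  have h2 : P.coincidenceForm r J (fun j => s * t j) v = s ^ 2 * P.coincidenceForm r J t v := by
    simp only [coincidenceForm, Finset.mul_sum]
    exact Finset.sum_congr rfl fun j _ => Finset.sum_congr rfl fun k _ => by ring
  rw [h2] at h1
  simp only [RCLike.inner_apply, conj_trivial, Finset.mul_sum, ← mul_assoc]
  refine h1.trans ?_
  congr 1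
  rw [Real.coe_toNNReal _ h0]
  push_cast
  ring

/-- The law of the limit process is characterized by its joint characteristic functions. -/
lemma isLimitLaw_of_jointCharFun {r : Fin b} {H : ProbabilityMeasure (PathSpace b)}
    (h : ∀ {ι : Type} (J : Finset ι) (t : ι → ℝ) (v : ι → InfString b),
      jointCharFun (H : Measure (PathSpace b)) J t v
        = Complex.exp (-(P.coincidenceForm r J t v : ℝ) / 2)) :
    P.IsLimitLaw (P.prob r) H := by
  classical
  have hmap {ι : Type} (J : Finset ι) (t : ι → ℝ) (v : ι → InfString b) :=
    P.map_sum_eval_eq_gaussianReal h J t v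
  have hgauss {ι : Type} (J : Finset ι) (t : ι → ℝ) (v : ι → InfString b) :
      HasGaussianLaw (fun f : PathSpace b => ∑ j ∈ J, t j * f (v j))
        (H : Measure (PathSpace b)) := by
    refine ⟨?_⟩
    rw [(hmap J t v).2]
    infer_instance
  have hmean {ι : Type} (J : Finset ι) (t : ι → ℝ) (v : ι → InfString b) :
      ∫ f : PathSpace b, ∑ j ∈ J, t j * f (v j) ∂(H : Measure (PathSpace b)) = 0 := by
    have := integral_map (μ := (H : Measure (PathSpace b)))
      (PathSpace.measurable_sum_eval J t v).aemeasurable (f := fun x : ℝ => x) (by fun_prop)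
    rw [← this, (hmap J t v).2, integral_id_gaussianReal]
  have hsq {ι : Type} (J : Finset ι) (t : ι → ℝ) (v : ι → InfString b) :
      ∫ f : PathSpace b, (∑ j ∈ J, t j * f (v j)) ^ 2 ∂(H : Measure (PathSpace b))
        = P.coincidenceForm r J t v := by
    rw [← variance_of_integral_eq_zero
      (PathSpace.measurable_sum_eval J t v).aemeasurable (hmean J t v)]
    have := variance_map (μ := (H : Measure (PathSpace b))) (X := fun x : ℝ => x)
      (by fun_prop) (PathSpace.measurable_sum_eval J t v).aemeasurable
    rw [(hmap J t v).2, variance_fun_id_gaussianReal] at this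
    rw [Real.coe_toNNReal _ (hmap J t v).1] at this
    exact this.symm
  have hL2 (w : InfString b) : MemLp (fun f : PathSpace b => f w) 2
      (H : Measure (PathSpace b)) := by
    simpa using (hgauss {()} (fun _ => 1) (fun _ => w)).memLp_two
  refine ⟨⟨fun I => ⟨?_⟩⟩, fun w => ?_, fun v w => ?_⟩
  · have hmeas : Measurable fun f : PathSpace b => I.restrict fun v => f v :=
      measurable_pi_lambda _ fun i => Continuous.measurable (by fun_prop)
    refine isGaussian_of_map_eq_gaussianReal fun L =>
      ⟨0, (P.coincidenceForm r Finset.univ (fun i : I => L (Pi.single i 1))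
        (fun i : I => (i : InfString b))).toNNReal, ?_⟩
    rw [Measure.map_map (by fun_prop) hmeas, ← (hmap _ _ _).2]
    congr 1
    ext f
    simp only [Function.comp_apply]
    conv_lhs => rw [← Finset.univ_sum_single (I.restrict fun v => f v)]
    rw [map_sum]
    refine Finset.sum_congr rfl fun i _ => ?_
    have : (Pi.single i (I.restrict (fun v => f v) i) : I → ℝ)
        = f i • (Pi.single i (1 : ℝ) : I → ℝ) := by
      rw [← Pi.single_smul]; simp
    rw [this, map_smul, smul_eq_mul, mul_comm]
  · simpa using hmean {()} (fun _ => 1) (fun _ => w)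
  · -- The mixed moment is recovered from the second moments by polarization.
    have h1 := hsq (Finset.univ : Finset Bool) (fun _ => 1) (fun i => if i then v else w)
    have h2 := hsq {()} (fun _ => 1) (fun _ => v)
    have h3 := hsq {()} (fun _ => 1) (fun _ => w)
    have hi : Integrable (fun f : PathSpace b => f v * f w) (H : Measure (PathSpace b)) :=
      (hL2 v).integrable_mul (hL2 w)
    have hv : Integrable (fun f : PathSpace b => f v ^ 2) (H : Measure (PathSpace b)) :=
      (hL2 v).integrable_sq
    have hw : Integrable (fun f : PathSpace b => f w ^ 2) (H : Measure (PathSpace b)) :=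
      (hL2 w).integrable_sq
    have hexp (f : PathSpace b) : (f v + f w) ^ 2 = f v ^ 2 + f w ^ 2 + 2 * (f v * f w) := by ring
    have hi2 := hi.const_mul 2
    have hvw := hv.add hw
    simp only [coincidenceForm, Fintype.sum_bool, if_true, Bool.false_eq_true, if_false, one_mul,
      Finset.sum_singleton, hexp] at h1 h2 h3
    rw [integral_add (f := fun f : PathSpace b => f v ^ 2 + f w ^ 2) hvw hi2,
      integral_add hv hw, h2, h3, integral_const_mul] at h1
    have hsymm : P.coincidenceCov r w v = P.coincidenceCov r v w := covariance_comm _ _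
    change _ = P.coincidenceCov r v w
    linarith

/-- The noise of the fixed-point equation is a centered Gaussian vector. -/
lemma noiseCharFun_eq {ι : Type*} (r : Fin b) (J : Finset ι) (t : ι → ℝ) (v : ι → InfString b) :
    P.noiseCharFun r J t v = Complex.exp (-((∑ j ∈ J, ∑ k ∈ J, t j * t k *
      (P.meanFun (P.prob (v j 0)) (v j).tail * P.meanFun (P.prob (v k 0)) (v k).tail
        * P.noiseCov r (v j 0) (v k 0)) : ℝ) : ℂ) / 2) := by
  classical
  let y : EuclideanSpace ℝ (Fin b) := WithLp.toLp 2 fun a => ∑ j ∈ J,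
    if v j 0 = a then t j * P.meanFun (P.prob (v j 0)) (v j).tail else 0
  have hy (a : Fin b) : y a = ∑ j ∈ J,
    if v j 0 = a then t j * P.meanFun (P.prob (v j 0)) (v j).tail else 0 := rfl
  have h := charFun_multivariateGaussian (μ := 0) (P.posSemidef_noiseCov r) y
  rw [charFun_apply] at h
  have hinner (x : EuclideanSpace ℝ (Fin b)) :
      ∑ j ∈ J, t j * P.noiseOp x (v j) = inner ℝ x y := by
    simp only [PiLp.inner_apply, RCLike.inner_apply, conj_trivial, hy, Finset.sum_mul, ite_mul,
      zero_mul]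
    rw [Finset.sum_comm]
    refine Finset.sum_congr rfl fun j _ => ?_
    rw [Finset.sum_ite_eq, if_pos (Finset.mem_univ _), mul_assoc]
    rfl
  have hform : y.ofLp ⬝ᵥ (P.noiseCov r).mulVec y.ofLp = ∑ j ∈ J, ∑ k ∈ J, t j * t k *
      (P.meanFun (P.prob (v j 0)) (v j).tail * P.meanFun (P.prob (v k 0)) (v k).tail
        * P.noiseCov r (v j 0) (v k 0)) := by
    have h1 (g : Fin b → ℝ) : y.ofLp ⬝ᵥ g
        = ∑ j ∈ J, t j * P.meanFun (P.prob (v j 0)) (v j).tail * g (v j 0) := by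
      simp only [dotProduct, hy, Finset.sum_mul, ite_mul, zero_mul]
      rw [Finset.sum_comm]
      refine Finset.sum_congr rfl fun j _ => ?_
      rw [Finset.sum_ite_eq, if_pos (Finset.mem_univ _)]
    rw [h1]
    refine Finset.sum_congr rfl fun j _ => ?_
    rw [Matrix.mulVec, dotProduct_comm, h1, Finset.mul_sum]
    exact Finset.sum_congr rfl fun k _ => by ring
  rw [noiseCharFun]
  simp_rw [hinner]
  refine h.trans ?_
  rw [hform, inner_zero_right]
  congr 1
  push_cast
  ring

lemma coincidenceForm_recursion {ι : Type*} (r : Fin b) (J : Finset ι) (t : ι → ℝ)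
    (v : ι → InfString b) :
    P.coincidenceForm r J t v
      = (∑ a, P.coincidenceForm a (J.filter fun j => v j 0 = a) (fun j => √(P.prob r a) * t j)
          fun j => (v j).tail)
        + ∑ j ∈ J, ∑ k ∈ J, t j * t k *
          (P.meanFun (P.prob (v j 0)) (v j).tail * P.meanFun (P.prob (v k 0)) (v k).tail
            * P.noiseCov r (v j 0) (v k 0)) := by
  have h1 : ∑ a, P.coincidenceForm a (J.filter fun j => v j 0 = a) (fun j => √(P.prob r a) * t j)
        (fun j => (v j).tail)
      = ∑ j ∈ J, ∑ k ∈ J, t j * t k * ∑ a, if v j 0 = a ∧ v k 0 = a then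
          P.prob r a * P.coincidenceCov a (v j).tail (v k).tail else 0 := by
    simp only [coincidenceForm, Finset.mul_sum, Finset.sum_filter]
    rw [Finset.sum_comm]
    refine Finset.sum_congr rfl fun j _ => ?_
    rw [Finset.sum_comm]
    refine Finset.sum_congr rfl fun a _ => ?_
    by_cases hj : v j 0 = a
    · rw [if_pos hj]
      refine Finset.sum_congr rfl fun k _ => ?_
      by_cases hk : v k 0 = a
      · rw [if_pos hk, if_pos ⟨hj, hk⟩]
        have := Real.mul_self_sqrt (P.pos r a).le
        linear_combination t j * t k * P.coincidenceCov a (v j).tail (v k).tail * this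
      · rw [if_neg hk, if_neg fun h => hk h.2, mul_zero]
    · rw [if_neg hj]
      exact (Finset.sum_eq_zero fun k _ => by rw [if_neg fun h => hj h.1, mul_zero]).symm
  rw [h1, ← Finset.sum_add_distrib]
  refine Finset.sum_congr rfl fun j _ => ?_
  rw [← Finset.sum_add_distrib]
  refine Finset.sum_congr rfl fun k _ => ?_
  rw [coincidenceCov_recursion]
  ring

/-- The limit laws solve the fixed-point system, as both sides are centered Gaussian with the same
covariances. -/
theorem solvesFixedPointSystem_of_isLimitLaw {H : Fin b → ProbabilityMeasure (PathSpace b)}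
    (hH : ∀ r, P.IsLimitLaw (P.prob r) (H r)) : P.SolvesFixedPointSystem H := by
  intro r
  have : IsProbabilityMeasure (((Measure.pi fun k => (H k : Measure (PathSpace b))).prod
      (P.noiseLaw r)).map fun z => P.fixedPointMap r z.1 z.2) :=
    Measure.isProbabilityMeasure_map (P.continuous_fixedPointMap r).measurable.aemeasurable
  refine PathSpace.ext_of_jointCharFun fun J t => ?_
  rw [jointCharFun_map_fixedPointMap, noiseCharFun_eq, P.jointCharFun_of_isLimitLaw (hH r),
    Finset.prod_congr rfl fun a _ => P.jointCharFun_of_isLimitLaw (hH a) _ _ _, ← Complex.exp_sum,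
    ← Complex.exp_add, coincidenceForm_recursion]
  congr 1
  push_cast
  rw [← Finset.sum_div, Finset.sum_neg_distrib]
  ring

end TransitionMatrix

/-! ### The isonormal Gaussian process -/

/-- Characteristic functions are continuous in `L²`, so that Gaussian laws persist in limits. -/
lemma lipschitz_integral_expI {Ω : Type*} [MeasurableSpace Ω] {μ : Measure Ω}
    [IsProbabilityMeasure μ] :
    LipschitzWith 1 fun X : Lp ℝ 2 μ => ∫ ω, Complex.exp ((X ω : ℂ) * Complex.I) ∂μ := by
  refine LipschitzWith.of_dist_le_mul fun X Y => ?_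
  have hm (Z : Lp ℝ 2 μ) : AEMeasurable Z μ := (Lp.aestronglyMeasurable Z).aemeasurable
  rw [dist_eq_norm, dist_eq_norm, NNReal.coe_one, one_mul,
    ← integral_sub (integrable_expI (hm X)) (integrable_expI (hm Y))]
  have hXY : MemLp (⇑(X - Y)) 2 μ := Lp.memLp _
  have h1 : ‖∫ ω, (Complex.exp ((X ω : ℂ) * Complex.I) - Complex.exp ((Y ω : ℂ) * Complex.I)) ∂μ‖
      ≤ ∫ ω, ‖(X - Y : Lp ℝ 2 μ) ω‖ ∂μ := by
    refine norm_integral_le_of_norm_le (hXY.integrable (by norm_num)).norm ?_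
    filter_upwards [Lp.coeFn_sub X Y] with ω hω
    rw [hω, Pi.sub_apply]
    have h2 : Complex.exp ((X ω : ℂ) * Complex.I) - Complex.exp ((Y ω : ℂ) * Complex.I)
        = Complex.exp ((Y ω : ℂ) * Complex.I)
          * (Complex.exp (Complex.I * ((X ω - Y ω : ℝ) : ℂ)) - 1) := by
      rw [mul_sub, ← Complex.exp_add, mul_one]
      congr 2
      push_cast
      ring
    rw [h2, norm_mul, Complex.norm_exp_ofReal_mul_I, one_mul]
    exact Real.norm_exp_I_mul_ofReal_sub_one_le
  refine h1.trans ?_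
  rw [integral_norm_eq_lintegral_enorm hXY.1, ← eLpNorm_one_eq_lintegral_enorm, Lp.norm_def]
  exact ENNReal.toReal_mono hXY.eLpNorm_ne_top
    (eLpNorm_le_eLpNorm_of_exponent_le (by norm_num) hXY.1)

lemma integral_sq_eq_norm_sq {Ω : Type*} [MeasurableSpace Ω] {μ : Measure Ω} (X : Lp ℝ 2 μ) :
    ∫ ω, X ω ^ 2 ∂μ = ‖X‖ ^ 2 := by
  rw [← real_inner_self_eq_norm_sq, L2.inner_def]
  simp [sq]

/-- A linear isometry `W` of a Hilbert space into the square-integrable random variables is an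
isonormal Gaussian process if all `W x` are centered Gaussian. Their variances are then `‖x‖ ^ 2`,
and by linearity the family is jointly Gaussian; the condition is expressed by the characteristic
functions at frequency `1`. -/
def IsIsonormal {E Ω : Type*} [NormedAddCommGroup E] [InnerProductSpace ℝ E] [MeasurableSpace Ω]
    {Q : Measure Ω} (W : E →ₗᵢ[ℝ] Lp ℝ 2 Q) : Prop :=
  ∀ x, ∫ ω, Complex.exp ((W x ω : ℂ) * Complex.I) ∂Q = Complex.exp (-((‖x‖ ^ 2 : ℝ) : ℂ) / 2)

/-- On every real Hilbert space there is an isonormal Gaussian process. The one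
constructed here maps a Hilbert basis to independent standard Gaussian variables. -/
theorem exists_isonormal.{u} (E : Type u) [NormedAddCommGroup E] [InnerProductSpace ℝ E]
    [CompleteSpace E] : ∃ (ι : Type u) (μ : Measure (ι → ℝ)) (_ : IsProbabilityMeasure μ)
      (W : E →ₗᵢ[ℝ] Lp ℝ 2 μ), IsIsonormal W := by
  classical
  obtain ⟨s, B, -⟩ := exists_hilbertBasis ℝ E
  let μ : Measure (s → ℝ) := Measure.infinitePi fun _ => gaussianReal 0 1
  have hlaw (i : s) : μ.map (fun ω => ω i) = gaussianReal 0 1 := Measure.infinitePi_map_eval _ i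
  have hG (i : s) : HasGaussianLaw (fun ω : s → ℝ => ω i) μ :=
    ⟨by rw [hlaw i]; infer_instance⟩
  have hmean (i : s) : ∫ ω, ω i ∂μ = 0 := by
    have := integral_map (μ := μ) (φ := fun ω : s → ℝ => ω i)
      (measurable_pi_apply i).aemeasurable
      (f := fun x : ℝ => x) (by fun_prop)
    rw [← this, hlaw, integral_id_gaussianReal]
  have hindep : iIndepFun (fun (i : s) (ω : s → ℝ) => ω i) μ :=
    iIndepFun_infinitePi (X := fun _ x => x) fun _ => measurable_id
  have hproc : IsGaussianProcess (fun (i : s) (ω : s → ℝ) => ω i) μ :=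
    ⟨fun I => iIndepFun.hasGaussianLaw (fun i => hG i) (hindep.precomp Subtype.val_injective)⟩
  let ξ (i : s) : Lp ℝ 2 μ := (hG i).memLp_two.toLp _
  have hξ (i : s) : ξ i =ᵐ[μ] fun ω => ω i := MemLp.coeFn_toLp _
  have horth : Orthonormal ℝ ξ := by
    rw [orthonormal_iff_ite]
    intro i j
    rw [L2.inner_def]
    have h1 : ∫ ω, inner ℝ (ξ i ω) (ξ j ω) ∂μ = ∫ ω, ω i * ω j ∂μ := by
      refine integral_congr_ae ?_
      filter_upwards [hξ i, hξ j] with ω h1 h2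
      simp [h1, h2, mul_comm]
    rw [h1]
    split_ifs with hij
    · subst hij
      have h2 := variance_of_integral_eq_zero (hG i).aemeasurable (hmean i)
      have h3 := variance_map (μ := μ) (X := fun x : ℝ => x) (by fun_prop) (hG i).aemeasurable
      rw [hlaw, variance_fun_id_gaussianReal] at h3
      simp only [← sq]
      rw [← h2]
      exact h3.symm.trans (by simp)
    · have h2 := (hindep.indepFun hij).integral_fun_mul_eq_mul_integral
        (hG i).aemeasurable.aestronglyMeasurable (hG j).aemeasurable.aestronglyMeasurable
      rw [h2, hmean, zero_mul]
  let W : E →ₗᵢ[ℝ] Lp ℝ 2 μ :=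
    horth.orthogonalFamily.linearIsometry.comp B.repr.toLinearIsometry
  have hWB (i : s) : W (B i) = ξ i := by
    simp [W, B.repr_self, LinearIsometry.toSpanSingleton_apply]
  refine ⟨s, μ, inferInstance, W, fun x => ?_⟩
  have hfin (c : s → ℝ) (I : Finset s) :
      ∫ ω, Complex.exp ((W (∑ i ∈ I, c i • B i) ω : ℂ) * Complex.I) ∂μ
        = Complex.exp (-((‖∑ i ∈ I, c i • B i‖ ^ 2 : ℝ) : ℂ) / 2) := by
    set y := ∑ i ∈ I, c i • B i with hy
    have hae : (fun ω : s → ℝ => ∑ i ∈ I, c i * ω i) =ᵐ[μ] W y := by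
      have h1 : W y = ∑ i ∈ I, c i • ξ i := by simp [hy, hWB]
      rw [h1]
      refine Filter.EventuallyEq.symm ((Lp.coeFn_finsetSum _ _).trans ?_)
      have h2 : ∀ᵐ ω ∂μ, ∀ i ∈ I, (c i • ξ i : Lp ℝ 2 μ) ω = c i * ω i := by
        refine (Finset.eventually_all I).2 fun i _ => ?_
        filter_upwards [Lp.coeFn_smul (c i) (ξ i), hξ i] with ω h3 h4
        rw [h3, Pi.smul_apply, h4, smul_eq_mul]
      filter_upwards [h2] with ω h
      rw [Finset.sum_apply]
      exact Finset.sum_congr rfl h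
    have hlin : HasGaussianLaw (W y) μ := by
      have := (hproc.smul c).hasGaussianLaw_fun_sum (I := I)
      exact this.congr hae
    have hm : ∫ ω, W y ω ∂μ = 0 := by
      rw [← integral_congr_ae hae,
        integral_finsetSum _ fun i _ => ((hG i).integrable).const_mul _]
      simp [integral_const_mul, hmean]
    have hv : Var[W y; μ] = ‖y‖ ^ 2 := by
      rw [variance_of_integral_eq_zero hlin.aemeasurable hm, integral_sq_eq_norm_sq,
        W.norm_map]
    have h := hlin.charFun_map_eq 1
    rw [charFun_apply, integral_map hlin.aemeasurable (by fun_prop)] at h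
    simp only [RCLike.inner_apply, map_one, mul_one, one_mul, hm, conj_trivial] at h
    refine h.trans ?_
    rw [hv]
    congr 1
    simp [neg_div]
  have hlim := B.hasSum_repr x
  have hL := ((lipschitz_integral_expI.continuous.comp W.continuous).tendsto x).comp hlim
  have hR : Continuous fun y : E => Complex.exp (-((‖y‖ ^ 2 : ℝ) : ℂ) / 2) := by fun_prop
  refine tendsto_nhds_unique hL (((hR.tendsto x).comp hlim).congr fun I => ?_)
  exact (hfin _ I).symm

/-! ### Construction of the limit process -/

lemma map_isonormal {E Ω : Type*} [NormedAddCommGroup E] [InnerProductSpace ℝ E]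
    [MeasurableSpace Ω] {Q : Measure Ω} [IsProbabilityMeasure Q] {W : E →ₗᵢ[ℝ] Lp ℝ 2 Q}
    (hW : IsIsonormal W) (x : E) :
    Q.map (W x) = (gaussianReal 0 1).map (‖x‖ * ·) := by
  have hm : AEMeasurable (W x) Q := (Lp.aestronglyMeasurable (W x)).aemeasurable
  have : IsProbabilityMeasure (Q.map (W x)) := Measure.isProbabilityMeasure_map hm
  refine Measure.ext_of_charFun ?_
  ext s
  rw [charFun_map_mul, charFun_gaussianReal, charFun_apply, integral_map hm (by fun_prop)]
  have h1 : ∫ ω, Complex.exp ((inner ℝ (W x ω) s : ℂ) * Complex.I) ∂Q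
      = ∫ ω, Complex.exp ((W (s • x) ω : ℂ) * Complex.I) ∂Q := by
    refine integral_congr_ae ?_
    rw [map_smul]
    filter_upwards [Lp.coeFn_smul s (W x)] with ω hω
    rw [hω]
    simp
  rw [h1, hW, norm_smul]
  congr 1
  simp only [mul_pow, Real.norm_eq_abs, sq_abs]
  push_cast
  simp
  ring

lemma fourth_moment_isonormal {E Ω : Type*} [NormedAddCommGroup E] [InnerProductSpace ℝ E]
    [MeasurableSpace Ω] {Q : Measure Ω} [IsProbabilityMeasure Q] {W : E →ₗᵢ[ℝ] Lp ℝ 2 Q}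
    (hW : IsIsonormal W) (x : E) :
    Integrable (fun ω => W x ω ^ 4) Q ∧
      ∫ ω, W x ω ^ 4 ∂Q = ‖x‖ ^ 4 * ∫ y, y ^ 4 ∂(gaussianReal 0 1) := by
  have hm : AEMeasurable (W x) Q := (Lp.aestronglyMeasurable (W x)).aemeasurable
  have hi : Integrable (fun y : ℝ => y ^ 4) (gaussianReal 0 1) := by
    have h := (memLp_id_gaussianReal (μ := 0) (v := 1) ((4 : ℕ) : NNReal)).integrable_norm_pow
      (p := 4) (by norm_num)
    simpa [Even.pow_abs (show Even 4 by decide)] using h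
  have hi2 : Integrable (fun y : ℝ => y ^ 4) (Q.map (W x)) := by
    rw [map_isonormal hW, integrable_map_measure (by fun_prop) (by fun_prop)]
    simp only [Function.comp_def, mul_pow]
    exact hi.const_mul _
  refine ⟨hi2.comp_aemeasurable hm, ?_⟩
  have h1 := integral_map (μ := Q) hm (f := fun y : ℝ => y ^ 4) (by fun_prop)
  rw [← h1, map_isonormal hW, integral_map (by fun_prop) (by fun_prop)]
  simp_rw [mul_pow]
  rw [integral_const_mul]

/-- The class of `1_A - μ(A)` in `L²`. -/
def centeredIndicator {Ω : Type*} [MeasurableSpace Ω] (μ : Measure Ω) [IsProbabilityMeasure μ]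
    (A : Set Ω) (hA : MeasurableSet A) : Lp ℝ 2 μ :=
  MemLp.toLp (fun s => A.indicator (fun _ => (1 : ℝ)) s - μ.real A)
    ((memLp_indicator_const 2 hA 1 (Or.inr (measure_ne_top _ _))).sub (memLp_const _))

lemma coeFn_centeredIndicator {Ω : Type*} [MeasurableSpace Ω] (μ : Measure Ω)
    [IsProbabilityMeasure μ] (A : Set Ω) (hA : MeasurableSet A) :
    centeredIndicator μ A hA =ᵐ[μ] fun s => A.indicator (fun _ => (1 : ℝ)) s - μ.real A :=
  MemLp.coeFn_toLp _

lemma norm_sq_centeredIndicator_le {Ω : Type*} [MeasurableSpace Ω] (μ : Measure Ω)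
    [IsProbabilityMeasure μ] (A : Set Ω) (hA : MeasurableSet A) :
    ‖centeredIndicator μ A hA‖ ^ 2 ≤ μ.real A := by
  classical
  have hi : Integrable (A.indicator fun _ => (1 : ℝ)) μ := (integrable_const _).indicator hA
  rw [← integral_sq_eq_norm_sq]
  have h1 : ∫ s, centeredIndicator μ A hA s ^ 2 ∂μ
      = ∫ s, ((1 - 2 * μ.real A) * A.indicator (fun _ => (1 : ℝ)) s + μ.real A ^ 2) ∂μ := by
    refine integral_congr_ae ?_
    filter_upwards [coeFn_centeredIndicator μ A hA] with s hs
    rw [hs, Set.indicator_apply]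
    split_ifs <;> ring
  rw [h1, integral_add (hi.const_mul _) (integrable_const _), integral_const_mul,
    integral_indicator_const _ hA]
  simp only [smul_eq_mul, mul_one, integral_const, probReal_univ, one_mul]
  nlinarith [sq_nonneg (μ.real A)]

/-- The locally constant path whose value at a string is determined by its first `n` letters. -/
def levelPath {b n : ℕ} (g : (Fin n → Fin b) → ℝ) : PathSpace b where
  toFun v := g fun i : Fin n => v i
  continuous_toFun := (continuous_of_discreteTopology (f := g)).comp
    (continuous_pi fun _ => continuous_apply _)

lemma continuous_levelPath {b n : ℕ} : Continuous (levelPath (b := b) (n := n)) := by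
  refine ContinuousMap.continuous_of_continuous_uncurry _ ?_
  have h : Continuous fun y : (Fin n → Fin b) × ((Fin n → Fin b) → ℝ) => y.2 y.1 :=
    continuous_prod_of_discrete_left.2 fun u => continuous_apply u
  exact h.comp (f := fun y : ((Fin n → Fin b) → ℝ) × InfString b => (fun i : Fin n => y.2 i, y.1))
    ((continuous_pi fun _ => (continuous_apply _).comp continuous_snd).prodMk continuous_fst)

/-- A bound for the maximum of `|g|` that has a small expectation when the fourth moments of the
entries of `g` are small. -/
lemma norm_levelPath_le {b n : ℕ} (g : (Fin n → Fin b) → ℝ) {δ : ℝ} (hδ : 0 < δ) :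
    ‖levelPath g‖ ≤ δ + (∑ u, g u ^ 4) / δ ^ 3 := by
  have hS (u : Fin n → Fin b) : g u ^ 4 ≤ ∑ u, g u ^ 4 :=
    Finset.single_le_sum (f := fun u => g u ^ 4) (fun u _ => by positivity) (Finset.mem_univ u)
  refine (ContinuousMap.norm_le _ (by positivity)).2 fun v => ?_
  change |g fun i => v i| ≤ _
  set x := g fun i => v i with hx
  have h4 : |x| ^ 4 ≤ ∑ u, g u ^ 4 := by
    rw [show |x| ^ 4 = x ^ 4 from Even.pow_abs (by decide) x]; exact hS _
  rcases le_total |x| δ with h | h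
  · have : 0 ≤ (∑ u, g u ^ 4) / δ ^ 3 := by positivity
    linarith
  · have h1 : |x| ≤ |x| ^ 4 / δ ^ 3 := by
      rw [le_div_iff₀ (by positivity), pow_succ' _ 3]
      exact mul_le_mul_of_nonneg_left (pow_le_pow_left₀ hδ.le h 3) (abs_nonneg _)
    have h2 : |x| ^ 4 / δ ^ 3 ≤ (∑ u, g u ^ 4) / δ ^ 3 := by gcongr
    linarith

/-- Nonnegative random variables with summable expectations are almost surely summable. -/
lemma ae_summable_of_summable_integral {Ω : Type*} [MeasurableSpace Ω] {Q : Measure Ω}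
    {Y : ℕ → Ω → ℝ} (hi : ∀ n, Integrable (Y n) Q) (h0 : ∀ n ω, 0 ≤ Y n ω)
    (hs : Summable fun n => ∫ ω, Y n ω ∂Q) : ∀ᵐ ω ∂Q, Summable fun n => Y n ω := by
  have h1 : ∫⁻ ω, ∑' n, ENNReal.ofReal (Y n ω) ∂Q ≠ ∞ := by
    rw [lintegral_tsum fun n => (hi n).1.aemeasurable.ennreal_ofReal]
    simp_rw [← ofReal_integral_eq_lintegral_ofReal (hi _) (ae_of_all _ (h0 _))]
    exact hs.tsum_ofReal_ne_top
  filter_upwards [ae_lt_top' (AEMeasurable.tsum fun n =>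
    (hi n).1.aemeasurable.ennreal_ofReal) h1] with ω hω
  have := ENNReal.summable_toReal hω.ne
  simpa [ENNReal.toReal_ofReal (h0 _ ω)] using this

/-- The set of strings with a given initial word. -/
def wordCylinder {b n : ℕ} (u : Fin n → Fin b) : Set (InfString b) :=
  (fun (s : InfString b) (i : Fin n) => s i) ⁻¹' {u}

lemma measurable_prefix {b : ℕ} (n : ℕ) :
    Measurable fun (s : InfString b) (i : Fin n) => s i :=
  measurable_pi_lambda _ fun _ => measurable_pi_apply _

lemma measurableSet_wordCylinder {b n : ℕ} (u : Fin n → Fin b) :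
    MeasurableSet (wordCylinder u) := measurable_prefix n (measurableSet_singleton u)

lemma wordCylinder_prefix {b : ℕ} (n : ℕ) (v : InfString b) :
    wordCylinder (fun i : Fin n => v i) = PiNat.cylinder v n := by
  ext s
  simp only [wordCylinder, Set.mem_preimage, Set.mem_singleton_iff, funext_iff,
    PiNat.mem_cylinder_iff]
  exact ⟨fun h i hi => h ⟨i, hi⟩, fun h i => h i i.2⟩

namespace TransitionMatrix

variable {b : ℕ} (P : TransitionMatrix b)

lemma sum_real_wordCylinder (r : Fin b) (n : ℕ) :
    ∑ u : Fin n → Fin b, (P.sourceLaw (P.prob r)).real (wordCylinder u) = 1 := by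
  have : IsProbabilityMeasure ((P.sourceLaw (P.prob r)).map fun s (i : Fin n) => s i) :=
    Measure.isProbabilityMeasure_map (measurable_prefix n).aemeasurable
  have h1 := sum_measureReal_singleton
    (μ := (P.sourceLaw (P.prob r)).map fun s (i : Fin n) => s i) Finset.univ
  rw [Finset.coe_univ, probReal_univ] at h1
  rw [← h1]
  refine Finset.sum_congr rfl fun u _ => ?_
  rw [map_measureReal_apply (measurable_prefix n) (measurableSet_singleton u)]
  rfl

lemma real_wordCylinder_le {q : ℝ} (hq : ∀ i j, P.prob i j ≤ q) (r : Fin b) {n : ℕ}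
    (u : Fin n → Fin b) : (P.sourceLaw (P.prob r)).real (wordCylinder u) ≤ q ^ n := by
  let v : InfString b := fun i => if h : i < n then u ⟨i, h⟩ else r
  have hu : u = fun i : Fin n => v i := by ext i; simp [v]
  rw [hu, wordCylinder_prefix, real_sourceLaw_cylinder]
  exact P.prefixProb_le hq r v n

section construction

variable {Ω : Type*} [MeasurableSpace Ω] {Q : Measure Ω} {r : Fin b}
  (W : Lp ℝ 2 (P.sourceLaw (P.prob r)) →ₗᵢ[ℝ] Lp ℝ 2 Q)

/-- The contribution of the words of length `n` to the limit process: the string `v` gets the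
isonormal process at the centered indicator of the strings that share the first `n` letters
of `v`. -/
def levelNoise (n : ℕ) (ω : Ω) : PathSpace b :=
  levelPath fun u : Fin n → Fin b =>
    W (centeredIndicator _ (wordCylinder u) (measurableSet_wordCylinder u)) ω

lemma measurable_levelNoise (n : ℕ) : Measurable (P.levelNoise W n) :=
  continuous_levelPath.measurable.comp
    (measurable_pi_lambda _ fun _ => (Lp.stronglyMeasurable _).measurable)

lemma levelNoise_apply (n : ℕ) (ω : Ω) (v : InfString b) :
    P.levelNoise W n ω v = W (centeredIndicator _ (PiNat.cylinder v n)
      (InfString.measurableSet_cylinder v n)) ω := by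
  change W (centeredIndicator _ (wordCylinder fun i : Fin n => v i) _) ω = _
  congr 3
  simp only [wordCylinder_prefix]

/-- The fourth moments of the values at level `n` sum to at most `c * q ^ n`, since the variance at
a word is at most its probability, which is at most `q ^ n`. -/
lemma ae_summable_levelNoise [IsProbabilityMeasure Q] (hW : IsIsonormal W) :
    ∀ᵐ ω ∂Q, Summable fun n => P.levelNoise W (n + 1) ω := by
  obtain ⟨q, hq0', hq1, hq⟩ := P.exists_bound
  have hq0 : 0 < q := (P.pos r r).trans_le (hq r r)
  -- The thresholds `ρ ^ n` with `ρ ^ 4 = q` balance the two terms of `norm_levelPath_le`.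
  set ρ := √√q with hρ
  have hρ0 : 0 < ρ := Real.sqrt_pos.2 (Real.sqrt_pos.2 hq0)
  have hρ4 : ρ ^ 4 = q := by
    rw [show (4 : ℕ) = 2 * 2 from rfl, pow_mul, hρ, Real.sq_sqrt (Real.sqrt_nonneg _),
      Real.sq_sqrt hq0.le]
  have hρ1 : ρ < 1 := by
    by_contra h
    have := one_le_pow₀ (n := 4) (not_lt.1 h)
    linarith
  set c := ∫ y, y ^ 4 ∂(gaussianReal 0 1) with hc
  have hc0 : 0 ≤ c := integral_nonneg fun y => by positivity
  let G (n : ℕ) (u : Fin n → Fin b) (ω : Ω) : ℝ :=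
    W (centeredIndicator _ (wordCylinder u) (measurableSet_wordCylinder u)) ω
  have hGi (n : ℕ) (u : Fin n → Fin b) : Integrable (fun ω => G n u ω ^ 4) Q :=
    (fourth_moment_isonormal hW _).1
  have hG4 (n : ℕ) (u : Fin n → Fin b) :
      ∫ ω, G n u ω ^ 4 ∂Q ≤ q ^ n * (P.sourceLaw (P.prob r)).real (wordCylinder u) * c := by
    refine ((fourth_moment_isonormal hW _).2).trans_le ?_
    refine mul_le_mul_of_nonneg_right ?_ hc0
    have h1 := norm_sq_centeredIndicator_le (P.sourceLaw (P.prob r)) (wordCylinder u)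
      (measurableSet_wordCylinder u)
    rw [show (4 : ℕ) = 2 * 2 from rfl, pow_mul, sq]
    exact mul_le_mul (h1.trans (P.real_wordCylinder_le hq r u)) h1 (by positivity) (by positivity)
  let Y (n : ℕ) (ω : Ω) : ℝ := (∑ u, G (n + 1) u ω ^ 4) / (ρ ^ (n + 1)) ^ 3
  have hYi (n : ℕ) : Integrable (Y n) Q :=
    (integrable_finsetSum _ fun u _ => hGi (n + 1) u).div_const _
  have hY0 (n : ℕ) (ω : Ω) : 0 ≤ Y n ω := by positivity
  have hgeom : Summable fun n : ℕ => ρ ^ (n + 1) :=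
    (summable_nat_add_iff 1).2 (summable_geometric_of_lt_one hρ0.le hρ1)
  have hYint (n : ℕ) : ∫ ω, Y n ω ∂Q ≤ c * ρ ^ (n + 1) := by
    simp only [Y]
    rw [integral_div, integral_finsetSum _ fun u _ => hGi (n + 1) u, div_le_iff₀ (by positivity)]
    refine (Finset.sum_le_sum fun u _ => hG4 (n + 1) u).trans_eq ?_
    rw [← Finset.sum_mul, ← Finset.mul_sum, sum_real_wordCylinder, ← hρ4]
    ring
  have hYs : Summable fun n => ∫ ω, Y n ω ∂Q :=
    Summable.of_nonneg_of_le (fun n => integral_nonneg (hY0 n)) hYint (hgeom.mul_left c)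
  filter_upwards [ae_summable_of_summable_integral hYi hY0 hYs] with ω hω
  refine Summable.of_norm_bounded (hgeom.add hω) fun n => ?_
  exact norm_levelPath_le _ (by positivity)

/-- The covariance of truncated coincidences is the Gram matrix of the partial sums of centered
indicators of cylinders. -/
lemma inner_sum_centeredIndicator (n : ℕ) (v w : InfString b) :
    inner ℝ (∑ k ∈ Finset.range n, centeredIndicator (P.sourceLaw (P.prob r))
        (PiNat.cylinder v (k + 1)) (InfString.measurableSet_cylinder v (k + 1)))
      (∑ k ∈ Finset.range n, centeredIndicator (P.sourceLaw (P.prob r))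
        (PiNat.cylinder w (k + 1)) (InfString.measurableSet_cylinder w (k + 1)))
      = ∫ s, truncCoincidence n v s * truncCoincidence n w s ∂(P.sourceLaw (P.prob r))
        - (∫ s, truncCoincidence n v s ∂(P.sourceLaw (P.prob r)))
          * ∫ s, truncCoincidence n w s ∂(P.sourceLaw (P.prob r)) := by
  have hmem (v : InfString b) : MemLp (truncCoincidence n v) 2 (P.sourceLaw (P.prob r)) :=
    memLp_finsetSum _ fun k _ => memLp_indicator_const 2
      (InfString.measurableSet_cylinder v (k + 1)) 1 (Or.inr (measure_ne_top _ _))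
  have hae (v : InfString b) : (∑ k ∈ Finset.range n, centeredIndicator (P.sourceLaw (P.prob r))
        (PiNat.cylinder v (k + 1)) (InfString.measurableSet_cylinder v (k + 1)) :
          Lp ℝ 2 (P.sourceLaw (P.prob r)))
      =ᵐ[P.sourceLaw (P.prob r)] fun s => truncCoincidence n v s
        - ∫ s, truncCoincidence n v s ∂(P.sourceLaw (P.prob r)) := by
    have h1 : ∀ᵐ s ∂(P.sourceLaw (P.prob r)), ∀ k ∈ Finset.range n,
        centeredIndicator (P.sourceLaw (P.prob r)) (PiNat.cylinder v (k + 1))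
          (InfString.measurableSet_cylinder v (k + 1)) s
        = (PiNat.cylinder v (k + 1)).indicator (fun _ => (1 : ℝ)) s
          - (P.sourceLaw (P.prob r)).real (PiNat.cylinder v (k + 1)) :=
      (Finset.eventually_all _).2 fun k _ => coeFn_centeredIndicator _ _ _
    filter_upwards [Lp.coeFn_finsetSum (Finset.range n) fun k =>
      centeredIndicator (P.sourceLaw (P.prob r)) (PiNat.cylinder v (k + 1))
        (InfString.measurableSet_cylinder v (k + 1)), h1] with s h2 h3
    rw [h2, Finset.sum_apply, Finset.sum_congr rfl h3, Finset.sum_sub_distrib]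
    congr 1
    simp only [truncCoincidence]
    rw [integral_finsetSum _ fun k _ => (integrable_const _).indicator
      (InfString.measurableSet_cylinder _ _)]
    refine Finset.sum_congr rfl fun k _ => ?_
    rw [integral_indicator_const _ (InfString.measurableSet_cylinder _ _)]
    simp
  have hcov := covariance_eq_sub (hmem v) (hmem w)
  simp only [Pi.mul_apply] at hcov
  rw [← hcov, L2.inner_def, covariance]
  refine integral_congr_ae ?_
  filter_upwards [hae v, hae w] with s h1 h2
  rw [h1, h2]
  simp [mul_comm]

lemma integral_expI_sum_levelNoise (hW : IsIsonormal W) {ι : Type*} (n : ℕ) (J : Finset ι)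
    (t : ι → ℝ) (v : ι → InfString b) :
    ∫ ω, Complex.exp ((∑ j ∈ J, t j * (∑ k ∈ Finset.range n, P.levelNoise W (k + 1) ω) (v j) : ℝ)
        * Complex.I) ∂Q
      = Complex.exp (-((∑ j ∈ J, ∑ k ∈ J, t j * t k *
        (∫ s, truncCoincidence n (v j) s * truncCoincidence n (v k) s ∂(P.sourceLaw (P.prob r))
        - (∫ s, truncCoincidence n (v j) s ∂(P.sourceLaw (P.prob r)))
          * ∫ s, truncCoincidence n (v k) s ∂(P.sourceLaw (P.prob r))) : ℝ) : ℂ) / 2) := by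
  let z (w : InfString b) : Lp ℝ 2 (P.sourceLaw (P.prob r)) :=
    ∑ k ∈ Finset.range n, centeredIndicator (P.sourceLaw (P.prob r))
        (PiNat.cylinder w (k + 1)) (InfString.measurableSet_cylinder w (k + 1))
  have hz (w : InfString b) : W (z w) =ᵐ[Q]
      fun ω => (∑ k ∈ Finset.range n, P.levelNoise W (k + 1) ω) w := by
    simp only [z, map_sum]
    filter_upwards [Lp.coeFn_finsetSum (Finset.range n) fun k => W (centeredIndicator
      (P.sourceLaw (P.prob r)) (PiNat.cylinder w (k + 1))
        (InfString.measurableSet_cylinder w (k + 1)))] with ω hω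
    rw [hω, Finset.sum_apply, ContinuousMap.sum_apply]
    exact Finset.sum_congr rfl fun k _ => (P.levelNoise_apply W _ _ _).symm
  have hsum : W (∑ j ∈ J, t j • z (v j)) =ᵐ[Q] fun ω =>
      ∑ j ∈ J, t j * (∑ k ∈ Finset.range n, P.levelNoise W (k + 1) ω) (v j) := by
    have h1 : ∀ᵐ ω ∂Q, ∀ j ∈ J, (t j • W (z (v j)) : Lp ℝ 2 Q) ω
        = t j * (∑ k ∈ Finset.range n, P.levelNoise W (k + 1) ω) (v j) := by
      refine (Finset.eventually_all J).2 fun j _ => ?_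
      filter_upwards [Lp.coeFn_smul (t j) (W (z (v j))), hz (v j)] with ω h2 h3
      rw [h2, Pi.smul_apply, h3, smul_eq_mul]
    simp only [map_sum, map_smul]
    filter_upwards [Lp.coeFn_finsetSum J fun j => t j • W (z (v j)), h1] with ω h2 h3
    rw [h2, Finset.sum_apply, Finset.sum_congr rfl h3]
  have hcongr : ∫ ω, Complex.exp ((∑ j ∈ J, t j *
      (∑ k ∈ Finset.range n, P.levelNoise W (k + 1) ω) (v j) : ℝ) * Complex.I) ∂Q
      = ∫ ω, Complex.exp ((W (∑ j ∈ J, t j • z (v j)) ω : ℂ) * Complex.I) ∂Q := by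
    refine integral_congr_ae ?_
    filter_upwards [hsum] with ω hω
    rw [hω]
  have hnorm : ‖∑ j ∈ J, t j • z (v j)‖ ^ 2 = ∑ j ∈ J, ∑ k ∈ J, t j * t k *
        (∫ s, truncCoincidence n (v j) s * truncCoincidence n (v k) s ∂(P.sourceLaw (P.prob r))
        - (∫ s, truncCoincidence n (v j) s ∂(P.sourceLaw (P.prob r)))
          * ∫ s, truncCoincidence n (v k) s ∂(P.sourceLaw (P.prob r))) := by
    rw [← real_inner_self_eq_norm_sq, sum_inner]
    refine Finset.sum_congr rfl fun j _ => ?_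
    rw [inner_sum]
    refine Finset.sum_congr rfl fun k _ => ?_
    rw [real_inner_smul_left, real_inner_smul_right, inner_sum_centeredIndicator, mul_assoc]
  rw [hcongr, hW, hnorm]

end construction

/-- The limit process is the sum of the isonormal process over the centered indicators of
all nonempty prefixes. -/
theorem exists_isLimitLaw (r : Fin b) :
    ∃ H : ProbabilityMeasure (PathSpace b), P.IsLimitLaw (P.prob r) H := by
  obtain ⟨ι, Q, _, W, hW⟩ := exists_isonormal (Lp ℝ 2 (P.sourceLaw (P.prob r)))
  let S (n : ℕ) (ω : ι → ℝ) : PathSpace b := ∑ k ∈ Finset.range n, P.levelNoise W (k + 1) ω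
  let X (ω : ι → ℝ) : PathSpace b := ∑' k, P.levelNoise W (k + 1) ω
  have hS (n : ℕ) : Measurable (S n) :=
    Finset.measurable_sum _ fun k _ => P.measurable_levelNoise W (k + 1)
  have hlim : ∀ᵐ ω ∂Q, Filter.Tendsto (fun n => S n ω) Filter.atTop (𝓝 (X ω)) :=
    (P.ae_summable_levelNoise W hW).mono fun ω hω => hω.hasSum.tendsto_sum_nat
  have hX : AEMeasurable X Q :=
    aemeasurable_of_tendsto_metrizable_ae Filter.atTop (fun n => (hS n).aemeasurable) hlim
  refine ⟨⟨Q.map X, Measure.isProbabilityMeasure_map hX⟩, P.isLimitLaw_of_jointCharFun ?_⟩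
  intro κ J t v
  change jointCharFun (Q.map X) J t v = _
  have hcont : Continuous fun f : PathSpace b =>
      Complex.exp ((∑ j ∈ J, t j * f (v j) : ℝ) * Complex.I) := by fun_prop
  rw [jointCharFun, integral_map hX hcont.aestronglyMeasurable]
  have h1 : Filter.Tendsto (fun n => ∫ ω, Complex.exp ((∑ j ∈ J, t j * S n ω (v j) : ℝ)
      * Complex.I) ∂Q) Filter.atTop
      (𝓝 (∫ ω, Complex.exp ((∑ j ∈ J, t j * X ω (v j) : ℝ) * Complex.I) ∂Q)) := by
    refine tendsto_integral_of_dominated_convergence (fun _ => (1 : ℝ))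
      (fun n => (hcont.measurable.comp (hS n)).aestronglyMeasurable) (integrable_const _)
      (fun n => ae_of_all _ fun ω => (Complex.norm_exp_ofReal_mul_I _).le) ?_
    filter_upwards [hlim] with ω hω
    exact (hcont.tendsto (X ω)).comp hω
  refine tendsto_nhds_unique h1 ?_
  simp only [S, P.integral_expI_sum_levelNoise W hW]
  have h2 : Filter.Tendsto (fun n => ∑ j ∈ J, ∑ k ∈ J, t j * t k *
        (∫ s, truncCoincidence n (v j) s * truncCoincidence n (v k) s ∂(P.sourceLaw (P.prob r))
        - (∫ s, truncCoincidence n (v j) s ∂(P.sourceLaw (P.prob r)))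
          * ∫ s, truncCoincidence n (v k) s ∂(P.sourceLaw (P.prob r)))) Filter.atTop
      (𝓝 (P.coincidenceForm r J t v)) := by
    refine tendsto_finsetSum _ fun j _ => tendsto_finsetSum _ fun k _ => ?_
    rw [coincidenceCov_eq]
    exact ((P.tendsto_integral_truncCoincidence_mul r _ _).sub
      ((P.tendsto_integral_truncCoincidence r _).mul
        (P.tendsto_integral_truncCoincidence r _))).const_mul _
  have h3 : Continuous fun x : ℝ => Complex.exp (-(x : ℂ) / 2) := by fun_prop
  exact (h3.tendsto _).comp h2

end TransitionMatrix

end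

theorem proposition2p7 (b : ℕ) (hb : 2 ≤ b) (P : TransitionMatrix b) :
    (∃ H : Fin b → ProbabilityMeasure (PathSpace b), ∀ r, P.IsLimitLaw (P.prob r) (H r)) ∧
    ∀ H : Fin b → ProbabilityMeasure (PathSpace b), (∀ r, P.IsLimitLaw (P.prob r) (H r)) →
      P.SolvesFixedPointSystem H ∧
        ∀ X : Fin b → ProbabilityMeasure (PathSpace b), P.SolvesFixedPointSystem X → X = H := by
  refine ⟨⟨fun r => (P.exists_isLimitLaw r).choose, fun r => (P.exists_isLimitLaw r).choose_spec⟩,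
    fun H hH => ?_⟩
  have hsol := P.solvesFixedPointSystem_of_isLimitLaw hH
  exact ⟨hsol, fun X hX => hX.unique P hsol⟩
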